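/- **Proposition (Absence of transaction-triggered price manipulation in the dynamic-spread limit order book model).** *Model.* Let $T\ge 0$ and let $(\Omega,\mathcal F,(\mathcal F_t)_{t\in[0,T]},\mathbb P)$ be a filtered probability space satisfying the usual conditions. Let the unaffected best ask price $A^u$ and the unaffected best bid price $B^u$ be càdlàg martingales on $[0,T]$ with deterministic starting points $A^u_0$, $B^u_0$, with $\mathbb E\sup_{t\in[0,T]}|A^u_t|<\infty$ and $\mathbb E\sup_{t\in[0,T]}|B^u_t|<\infty$, and with $B^u_t\le A^u_t$ for all $t\in[0,T]$ almost surely. Let $\gamma\ge 0$, let $K\colon[0,T]\to(0,\infty)$ be bounded and Borel, let $\rho\colon[0,T]\to(0,\infty)$ be Lebesgue integrable, and put $q_t:=(\gamma+K_t)^{-1}$. An admissible strategy is a pair $(\Theta,\tilde\Theta)$ of adapted, nondecreasing, uniformly bounded càglàd processes on $[0,T+]$ with $\Theta_0=\tilde\Theta_0=0$: a left-continuous process on $[0,T]$ together with an $\mathcal F_T$-measurable terminal value $\Theta_{T+}\ge\Theta_T$ (resp. $\tilde\Theta_{T+}\ge\tilde\Theta_T$). Here $\Theta_t$ and $\tilde\Theta_t$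 are the numbers of shares bought and sold, $\Delta\Theta_t:=\Theta_{t+}-\Theta_t$, and $d\Theta$ is the Lebesgue–Stieltjes measure with distribution function $t\mapsto\Theta_{t+}$ (including atoms at $0$ and $T$); similarly for $\tilde\Theta$. For $x\in\mathbb R$ let $\mathcal A_0(x)$ be the set of admissible strategies with $\Theta_{T+}-\tilde\Theta_{T+}=x$ a.s. For initial impacts $D_0,\tilde D_0\ge 0$ let $$D_t=D_0e^{-\int_0^t\rho_s\,ds}+\int_{[0,t)}\Bigl(\gamma+K_se^{-\int_s^t\rho_u\,du}\Bigr)d\Theta_s-\int_{[0,t)}\gamma\Bigl(1-e^{-\int_s^t\rho_u\,du}\Bigr)d\tilde\Theta_s,$$ $$\tilde D_t=\tilde D_0e^{-\int_0^t\rho_s\,ds}+\int_{[0,t)}\Bigl(\gamma+K_se^{-\int_s^t\rho_u\,du}\Bigr)d\tilde\Theta_s-\int_{[0,t)}\gamma\Bigl(1-e^{-\int_s^t\rho_u\,du}\Bigr)d\Theta_s,$$ $A_t=A^u_t+D_t$, $B_t=B^u_t-\tilde D_t$, and let the execution costs be $$\mathcal C(\Theta,\tilde\Theta)=\int_{[0,T]}\Bigl(A_t+\frac{\Delta\Theta_t}{2q_t}\Bigr)d\Theta_t-\int_{[0,T]}\Bigl(B_t-\frac{\Delta\tilde\Theta_t}{2q_t}\Bigr)d\tilde\Theta_t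 .$$ The model *admits price manipulation* if there are $D_0,\tilde D_0\ge0$ and $(\Theta,\tilde\Theta)\in\mathcal A_0(0)$ with $\mathbb E\,\mathcal C(\Theta,\tilde\Theta)<0$. It *admits transaction-triggered price manipulation* if there are $D_0,\tilde D_0\ge 0$ and either $x\ge 0$ and $(\Theta^0,\tilde\Theta^0)\in\mathcal A_0(x)$ with $\mathbb E\,\mathcal C(\Theta^0,\tilde\Theta^0)<\inf\{\mathbb E\,\mathcal C(\Theta,0):(\Theta,0)\in\mathcal A_0(x)\}$, or $x\le 0$ and $(\Theta^0,\tilde\Theta^0)\in\mathcal A_0(x)$ with $\mathbb E\,\mathcal C(\Theta^0,\tilde\Theta^0)<\inf\{\mathbb E\,\mathcal C(0,\tilde\Theta):(0,\tilde\Theta)\in\mathcal A_0(x)\}$. For an admissible $\Theta$ define the temporary-impact cost $$J(\Theta)=\int_{[0,T]}\Bigl(D^{\gamma=0}_t+\tfrac{K_t}{2}\Delta\Theta_t\Bigr)d\Theta_t,\qquad D^{\gamma=0}_t=D_0e^{-\int_0^t\rho_s\,ds}+\int_{[0,t)}K_se^{-\int_s^t\rho_u\,du}\,d\Theta_s .$$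 *Claim.* 1. The model does not admit transaction-triggered price manipulation. 2. In particular, it does not admit price manipulation. 3. Let $x\ge0$, $D_0,\tilde D_0\ge0$, $(\Theta,\tilde\Theta)\in\mathcal A_0(x)$, and let $\check\Theta_t:=\min(\Theta_t,x)$, $t\in[0,T+]$. Then $\mathcal C(\Theta,\tilde\Theta)$ and $J(\check\Theta)$ are integrable, $(\check\Theta,0)\in\mathcal A_0(x)$, and $$\mathbb E\,\mathcal C(\Theta,\tilde\Theta)\ \ge\ A^u_0x+\frac{\gamma}{2}x^2+\mathbb E\,J(\check\Theta).$$ 4. For $x\ge 0$, $D_0,\tilde D_0\ge 0$ and every pure purchasing strategy $(\Theta,0)\in\mathcal A_0(x)$ (in particular for $(\check\Theta,0)$ in 3.), the martingale part and the permanent-impact part of the expected costs are $$\mathbb E\int_{[0,T]}A^u_t\,d\Theta_t=A^u_0x,\qquad \mathbb E\int_{[0,T]}\gamma\Bigl(\Theta_t+\frac{\Delta\Theta_t}{2}\Bigr)d\Theta_t=\frac{\gamma}{2}x^2,$$ and $\mathbb E\,\mathcal C(\Theta,0)=A^u_0x+\frac{\gamma}{2}x^2+\mathbb E\,J(\Theta)$.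 -/

import Mathlib

open MeasureTheory Set Filter Topology

/-- A real function of time is càdlàg on `[0, T]`: right-continuous at every `t ∈ [0, T]` (a void
condition at `t = T`), with a finite left limit at every `t ∈ (0, T]`. Values outside `[0, T]` are
irrelevant. -/
def IsCadlagOn (T : ℝ) (f : ℝ → ℝ) : Prop :=
  (∀ t ∈ Icc 0 T, ContinuousWithinAt f (Icc t T) t) ∧
    ∀ t ∈ Ioc 0 T, ∃ l : ℝ, Tendsto f (𝓝[Ico 0 t] t) (𝓝 l)

/-- The usual conditions for a filtration `(ℱ t)`, `t ∈ [0, T]`: right-continuity, and every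
`P`-null set (every subset of a measurable set of probability zero) belongs to `ℱ 0`. -/
structure UsualConditions {Ω : Type*} [MeasurableSpace Ω] (P : Measure Ω) {T : ℝ} (hT : 0 ≤ T)
    (ℱ : Filtration (Icc (0 : ℝ) T) ‹MeasurableSpace Ω›) : Prop where
  rightContinuous : ℱ.IsRightContinuous
  complete : ∀ s : Set Ω, P s = 0 → MeasurableSet[ℱ ⟨0, le_rfl, hT⟩] s

/-- `Z` is a càdlàg `H¹`-martingale on `[0, T]` with the deterministic starting point `z₀`, that is,
a càdlàg martingale with `E sup_{t ∈ [0, T]} |Z t| < ∞`. -/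
structure IsH1Martingale {Ω : Type*} [MeasurableSpace Ω] (P : Measure Ω) {T : ℝ}
    (ℱ : Filtration (Icc (0 : ℝ) T) ‹MeasurableSpace Ω›) (Z : ℝ → Ω → ℝ) (z₀ : ℝ) : Prop where
  martingale : Martingale (fun t : Icc (0 : ℝ) T => Z t) ℱ P
  cadlag : ∀ᵐ ω ∂P, IsCadlagOn T fun t => Z t ω
  sup_integrable : ∫⁻ ω, ⨆ t : Icc (0 : ℝ) T, ENNReal.ofReal |Z t ω| ∂P < ⊤
  start : ∀ᵐ ω ∂P, Z 0 ω = z₀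

/-- The data of the limit order book model on the probability space `(Ω, P)`, with the standing
assumptions on them. Functions of time are functions on `ℝ` of which only the values on `[0, T]`
are used. -/
structure DynamicSpreadModel {Ω : Type*} [MeasurableSpace Ω] (P : Measure Ω) where
  /-- time horizon -/
  T : ℝ
  T_nonneg : 0 ≤ T
  ℱ : Filtration (Icc (0 : ℝ) T) ‹MeasurableSpace Ω›
  usual : UsualConditions P T_nonneg ℱ
  /-- unaffected best ask price and its deterministic starting point -/
  Au : ℝ → Ω → ℝ
  a₀ : ℝ
  /-- unaffected best bid price and its deterministic starting point -/
  Bu : ℝ → Ω → ℝ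
  b₀ : ℝ
  ask_martingale : IsH1Martingale P ℱ Au a₀
  bid_martingale : IsH1Martingale P ℱ Bu b₀
  bid_le_ask : ∀ᵐ ω ∂P, ∀ t ∈ Icc 0 T, Bu t ω ≤ Au t ω
  /-- permanent impact coefficient -/
  γ : ℝ
  γ_nonneg : 0 ≤ γ
  /-- temporary price impact coefficient -/
  K : ℝ → ℝ
  K_pos : ∀ t ∈ Icc 0 T, 0 < K t
  K_bounded : ∃ C, ∀ t ∈ Icc 0 T, K t ≤ C
  K_borel : Measurable fun t : Icc (0 : ℝ) T => K t
  /-- resilience speed -/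
  ρ : ℝ → ℝ
  ρ_pos : ∀ t ∈ Icc 0 T, 0 < ρ t
  ρ_integrable : IntegrableOn ρ (Icc 0 T)

/-- A cumulative order process `(Θ t)`, `t ∈ [0, T+]`: an adapted, nondecreasing, (uniformly)
bounded, càglàd process with `Θ 0 = 0`. The value `Θ_{T+}` is `final`; each path is extended to the
real line by the value `0` before time `0` and by the value `Θ_{T+}` after time `T`. Right limits
exist because of monotonicity, and `0 ≤ Θ` follows from `Θ 0 = 0`. -/
structure OrderProcess {Ω : Type*} [MeasurableSpace Ω] {P : Measure Ω}
    (M : DynamicSpreadModel P) where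
  cum : ℝ → Ω → ℝ
  final : Ω → ℝ
  eq_zero : ∀ ω t, t ≤ 0 → cum t ω = 0
  eq_final : ∀ ω t, M.T < t → cum t ω = final ω
  mono : ∀ ω, Monotone fun t => cum t ω
  left_cont : ∀ ω t, ContinuousWithinAt (fun s => cum s ω) (Iic t) t
  bounded : ∃ C, ∀ ω t, cum t ω ≤ C
  adapted : ∀ t : Icc (0 : ℝ) M.T, Measurable[M.ℱ t] (cum t)
  final_measurable : Measurable[M.ℱ ⟨M.T, M.T_nonneg, le_rfl⟩] final

namespace OrderProcess

variable {Ω : Type*} [MeasurableSpace Ω] {P : Measure Ω} {M : DynamicSpreadModel P}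

/-- The order process without any trading. -/
instance : Zero (OrderProcess M) where
  zero :=
    { cum := fun _ _ => 0
      final := fun _ => 0
      eq_zero := fun _ _ _ => rfl
      eq_final := fun _ _ _ => rfl
      mono := fun _ => monotone_const
      left_cont := fun _ _ => continuousWithinAt_const
      bounded := ⟨0, fun _ _ => le_rfl⟩
      adapted := fun _ => measurable_const
      final_measurable := measurable_const }

/-- The order process truncated at the level `x ≥ 0`: it is equal to `Θ t` as long as `Θ t ≤ x`, and
to `x` otherwise. -/
def trunc (Θ : OrderProcess M) (x : ℝ) (hx : 0 ≤ x) : OrderProcess M where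
  cum t ω := min (Θ.cum t ω) x
  final ω := min (Θ.final ω) x
  eq_zero ω t ht := by rw [Θ.eq_zero ω t ht, min_eq_left hx]
  eq_final ω t ht := by rw [Θ.eq_final ω t ht]
  mono ω := (Θ.mono ω).min monotone_const
  left_cont ω t := (Θ.left_cont ω t).min continuousWithinAt_const
  bounded := ⟨x, fun _ _ => min_le_right _ _⟩
  adapted t := (Θ.adapted t).min measurable_const
  final_measurable := Θ.final_measurable.min measurable_const

/-- The Lebesgue-Stieltjes measure `dΘ` of a path: the measure with distribution function
`t ↦ Θ_{t+}`. It lives on `[0, T]` and includes the atoms at `0` and at `T`. -/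
noncomputable def measure (Θ : OrderProcess M) (ω : Ω) : Measure ℝ :=
  (Θ.mono ω).stieltjesFunction.measure

/-- The order `ΔΘ_t = Θ_{t+} - Θ_t` executed at time `t`. -/
noncomputable def jump (Θ : OrderProcess M) (t : ℝ) (ω : Ω) : ℝ :=
  Function.rightLim (fun s => Θ.cum s ω) t - Θ.cum t ω

end OrderProcess

namespace DynamicSpreadModel

variable {Ω : Type*} [MeasurableSpace Ω] {P : Measure Ω} (M : DynamicSpreadModel P)

/-- The height `q_t` of the order book, `1 / q_t = γ + K_t`. -/
noncomputable def q (t : ℝ) : ℝ := 1 / (M.γ + M.K t)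

/-- The decay factor `exp (-∫_s^t ρ_u du)`. -/
noncomputable def decay (s t : ℝ) : ℝ := Real.exp (-∫ u in s..t, M.ρ u)

/-- The price impact at time `t` on one side of the book with initial impact `d₀`, where `Θ` are the
orders executed against this side and `Ψ` those executed against the opposite side. -/
noncomputable def impact (d₀ : ℝ) (Θ Ψ : OrderProcess M) (t : ℝ) (ω : Ω) : ℝ :=
  d₀ * M.decay 0 t + ∫ s in Ico 0 t, (M.γ + M.K s * M.decay s t) ∂Θ.measure ω
    - ∫ s in Ico 0 t, M.γ * (1 - M.decay s t) ∂Ψ.measure ω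

/-- The best ask price `A_t = A^u_t + D_t` for purchases `Θ`, sales `Ψ` and `D_0 = d₀`. -/
noncomputable def ask (d₀ : ℝ) (Θ Ψ : OrderProcess M) (t : ℝ) (ω : Ω) : ℝ :=
  M.Au t ω + M.impact d₀ Θ Ψ t ω

/-- The best bid price `B_t = B^u_t - D̃_t` for purchases `Θ`, sales `Ψ` and `D̃_0 = e₀`. -/
noncomputable def bid (e₀ : ℝ) (Θ Ψ : OrderProcess M) (t : ℝ) (ω : Ω) : ℝ :=
  M.Bu t ω - M.impact e₀ Ψ Θ t ω

/-- The execution costs of the strategy with purchases `Θ` and sales `Ψ`, for the initial price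
impacts `D_0 = d₀` and `D̃_0 = e₀`. -/
noncomputable def cost (d₀ e₀ : ℝ) (Θ Ψ : OrderProcess M) (ω : Ω) : ℝ :=
  (∫ t in Icc 0 M.T, (M.ask d₀ Θ Ψ t ω + Θ.jump t ω / (2 * M.q t)) ∂Θ.measure ω)
    - ∫ t in Icc 0 M.T, (M.bid e₀ Θ Ψ t ω - Ψ.jump t ω / (2 * M.q t)) ∂Ψ.measure ω

/-- The expected execution costs. -/
noncomputable def expectedCost (d₀ e₀ : ℝ) (Θ Ψ : OrderProcess M) : ℝ :=
  ∫ ω, M.cost d₀ e₀ Θ Ψ ω ∂P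

/-- The strategy with purchases `Θ` and sales `Ψ` builds up the position `x` until time `T`
(a round trip if `x = 0`). -/
def Builds (x : ℝ) (Θ Ψ : OrderProcess M) : Prop :=
  ∀ᵐ ω ∂P, Θ.final ω - Ψ.final ω = x

/-- The temporary price impact `D^{γ=0}_t` of the purchases `Θ`. -/
noncomputable def tempImpact (d₀ : ℝ) (Θ : OrderProcess M) (t : ℝ) (ω : Ω) : ℝ :=
  d₀ * M.decay 0 t + ∫ s in Ico 0 t, M.K s * M.decay s t ∂Θ.measure ω

/-- The temporary impact costs `∫_{[0,T]} (D^{γ=0}_t + (K_t / 2) ΔΘ_t) dΘ_t` of the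
purchases `Θ`. -/
noncomputable def tempCost (d₀ : ℝ) (Θ : OrderProcess M) (ω : Ω) : ℝ :=
  ∫ t in Icc 0 M.T, (M.tempImpact d₀ Θ t ω + M.K t / 2 * Θ.jump t ω) ∂Θ.measure ω

/-- The model admits price manipulation: some round trip has strictly negative expected costs. -/
def AdmitsPriceManipulation : Prop :=
  ∃ d₀ e₀ : ℝ, 0 ≤ d₀ ∧ 0 ≤ e₀ ∧ ∃ Θ Ψ : OrderProcess M,
    M.Builds 0 Θ Ψ ∧ M.expectedCost d₀ e₀ Θ Ψ < 0

/-- The model admits transaction-triggered price manipulation: the expected costs of a buy program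
(a sell program) can be brought below the infimum over the pure purchasing (pure selling) strategies
by intermediate sell (buy) trades. The infima are taken in the extended real numbers. -/
def AdmitsTransactionTriggeredPriceManipulation : Prop :=
  (∃ x d₀ e₀ : ℝ, 0 ≤ x ∧ 0 ≤ d₀ ∧ 0 ≤ e₀ ∧ ∃ Θ₀ Ψ₀ : OrderProcess M, M.Builds x Θ₀ Ψ₀ ∧
    (M.expectedCost d₀ e₀ Θ₀ Ψ₀ : EReal) <
      ⨅ (Θ : OrderProcess M) (_ : M.Builds x Θ 0), (M.expectedCost d₀ e₀ Θ 0 : EReal)) ∨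
  (∃ x d₀ e₀ : ℝ, x ≤ 0 ∧ 0 ≤ d₀ ∧ 0 ≤ e₀ ∧ ∃ Θ₀ Ψ₀ : OrderProcess M, M.Builds x Θ₀ Ψ₀ ∧
    (M.expectedCost d₀ e₀ Θ₀ Ψ₀ : EReal) <
      ⨅ (Ψ : OrderProcess M) (_ : M.Builds x 0 Ψ), (M.expectedCost d₀ e₀ 0 Ψ : EReal))

end DynamicSpreadModel

/-!
For a position `x ≥ 0`, a strategy `(Θ, Ψ)` is compared with the pure purchasing strategy that
follows `Θ` until `x` shares have been bought, `Θ.trunc x`. The comparison rests on three facts.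

* Sales at the bid price earn at most what they would earn at the ask price, so the unaffected
  prices contribute at least `E ∫ A^u d(Θ - Ψ)`. This is `E [A^u_T (Θ_{T+} - Ψ_{T+})] = a₀ x`:
  sampling `A^u` at the next grid point to the right turns the integral into a sum whose expectation
  telescopes by the martingale property, and right-continuity together with domination by an
  integrable random variable allows the mesh to tend to zero (`IsH1Martingale.integral_integral`).
* Pathwise, the impact costs of each side split into its temporary costs, its own permanent impact
  `γ Θ_{T+}² / 2`, and a rebate caused by the permanent impact of the opposite side
  (`DynamicSpreadModel.integral_impact_add_jump`). The permanent impact of an order on the opposite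
  side builds up gradually, so the two rebates add up to at most
  `γ (∫ Ψ_t dΘ_t + ∫ Θ_t dΨ_t) ≤ γ Θ_{T+} Ψ_{T+}`, by Fubini's theorem for the product of the two
  Stieltjes measures. Hence the permanent part is at least `γ x² / 2`, with equality if `Ψ = 0`.
* The temporary costs are nonnegative and increase with the measure `dΘ`, and truncation decreases
  this measure (`OrderProcess.measure_trunc_le`, `DynamicSpreadModel.tempCost_mono`).

The resulting lower bound is attained by `(Θ.trunc x, 0)`, which excludes transaction-triggered
manipulation by buy programs; for `x = 0` the bound is nonnegative, which excludes price
manipulation. Sell programs are buy programs in the reflected book, where prices change their sign.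
-/

/-! ### Stieltjes measures of order processes -/

namespace OrderProcess

variable {Ω : Type*} [MeasurableSpace Ω] {P : Measure Ω} {M : DynamicSpreadModel P}

theorem cum_nonneg (Θ : OrderProcess M) (t : ℝ) (ω : Ω) : 0 ≤ Θ.cum t ω := by
  rcases le_total t 0 with h | h
  · rw [Θ.eq_zero ω t h]
  · rw [← Θ.eq_zero ω 0 le_rfl]
    exact Θ.mono ω h

theorem cum_le_final (Θ : OrderProcess M) (t : ℝ) (ω : Ω) : Θ.cum t ω ≤ Θ.final ω := by
  rw [← Θ.eq_final ω (max t M.T + 1) (by linarith [le_max_right t M.T])]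
  exact Θ.mono ω (by linarith [le_max_left t M.T])

theorem final_nonneg (Θ : OrderProcess M) (ω : Ω) : 0 ≤ Θ.final ω :=
  (Θ.cum_nonneg 0 ω).trans (Θ.cum_le_final 0 ω)

theorem exists_final_le (Θ : OrderProcess M) : ∃ C, ∀ ω, Θ.final ω ≤ C := by
  obtain ⟨C, hC⟩ := Θ.bounded
  exact ⟨C, fun ω => Θ.eq_final ω (M.T + 1) (by linarith) ▸ hC ω _⟩

theorem measurable_final (Θ : OrderProcess M) : Measurable Θ.final :=
  Θ.final_measurable.mono (M.ℱ.le _) le_rfl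

theorem leftLim_cum (Θ : OrderProcess M) (t : ℝ) (ω : Ω) :
    Function.leftLim (fun s => Θ.cum s ω) t = Θ.cum t ω :=
  (Θ.left_cont ω t).leftLim_eq

theorem leftLim_stieltjesFunction (Θ : OrderProcess M) (t : ℝ) (ω : Ω) :
    Function.leftLim (Θ.mono ω).stieltjesFunction t = Θ.cum t ω := by
  rw [← Θ.leftLim_cum t ω]
  exact leftLim_rightLim ((Θ.mono ω).tendsto_leftLim t)

theorem tendsto_stieltjesFunction_atBot (Θ : OrderProcess M) (ω : Ω) :
    Tendsto (Θ.mono ω).stieltjesFunction atBot (𝓝 0) := by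
  refine tendsto_const_nhds.congr' ?_
  filter_upwards [eventually_lt_atBot (0 : ℝ)] with t ht
  refine le_antisymm ?_ ?_
  · exact (Θ.cum_nonneg t ω).trans ((Θ.mono ω).le_rightLim le_rfl)
  · exact ((Θ.mono ω).rightLim_le ht).trans_eq (Θ.eq_zero ω 0 le_rfl)

theorem tendsto_stieltjesFunction_atTop (Θ : OrderProcess M) (ω : Ω) :
    Tendsto (Θ.mono ω).stieltjesFunction atTop (𝓝 (Θ.final ω)) := by
  refine tendsto_const_nhds.congr' ?_
  filter_upwards [eventually_gt_atTop M.T] with t ht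
  refine le_antisymm ?_ ?_
  · rw [← Θ.eq_final ω t ht]
    exact (Θ.mono ω).le_rightLim le_rfl
  · exact ((Θ.mono ω).rightLim_le (lt_add_one t)).trans (Θ.cum_le_final _ ω)

theorem measure_univ (Θ : OrderProcess M) (ω : Ω) :
    Θ.measure ω univ = ENNReal.ofReal (Θ.final ω) := by
  rw [measure, StieltjesFunction.measure_univ _ (Θ.tendsto_stieltjesFunction_atBot ω)
    (Θ.tendsto_stieltjesFunction_atTop ω), sub_zero]

instance (Θ : OrderProcess M) (ω : Ω) : IsFiniteMeasure (Θ.measure ω) :=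
  ⟨by rw [Θ.measure_univ]; exact ENNReal.ofReal_lt_top⟩

theorem measure_Iio (Θ : OrderProcess M) (t : ℝ) (ω : Ω) :
    Θ.measure ω (Iio t) = ENNReal.ofReal (Θ.cum t ω) := by
  rw [measure, StieltjesFunction.measure_Iio _ (Θ.tendsto_stieltjesFunction_atBot ω),
    Θ.leftLim_stieltjesFunction, sub_zero]

theorem measure_real_univ (Θ : OrderProcess M) (ω : Ω) :
    (Θ.measure ω).real univ = Θ.final ω := by
  rw [Measure.real, Θ.measure_univ, ENNReal.toReal_ofReal (Θ.final_nonneg ω)]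

theorem measure_real_Iio (Θ : OrderProcess M) (t : ℝ) (ω : Ω) :
    (Θ.measure ω).real (Iio t) = Θ.cum t ω := by
  rw [Measure.real, Θ.measure_Iio, ENNReal.toReal_ofReal (Θ.cum_nonneg t ω)]

theorem measure_real_Ico (Θ : OrderProcess M) {s t : ℝ} (hst : s ≤ t) (ω : Ω) :
    (Θ.measure ω).real (Ico s t) = Θ.cum t ω - Θ.cum s ω := by
  have h : Ico s t = Iio t \ Iio s := by ext u; simp
  rw [h, measureReal_sdiff (Iio_subset_Iio hst) measurableSet_Iio, Θ.measure_real_Iio,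
    Θ.measure_real_Iio]

theorem measure_real_singleton (Θ : OrderProcess M) (t : ℝ) (ω : Ω) :
    (Θ.measure ω).real {t} = Θ.jump t ω := by
  rw [Measure.real, measure, StieltjesFunction.measure_singleton, Θ.leftLim_stieltjesFunction,
    ENNReal.toReal_ofReal, jump, Monotone.stieltjesFunction_eq]
  rw [sub_nonneg, Monotone.stieltjesFunction_eq]
  exact (Θ.mono ω).le_rightLim le_rfl

theorem measure_real_Iic (Θ : OrderProcess M) (t : ℝ) (ω : Ω) :
    (Θ.measure ω).real (Iic t) = Θ.cum t ω + Θ.jump t ω := by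
  rw [← Iio_insert, insert_eq, union_comm, measureReal_union (by simp) (measurableSet_singleton t),
    Θ.measure_real_Iio, Θ.measure_real_singleton]

theorem measure_compl_Icc (Θ : OrderProcess M) (ω : Ω) : Θ.measure ω (Icc 0 M.T)ᶜ = 0 := by
  have h0 : Θ.measure ω (Iio 0) = 0 := by
    rw [Θ.measure_Iio, Θ.eq_zero ω 0 le_rfl, ENNReal.ofReal_zero]
  have hT : Θ.measure ω (Ioi M.T) = 0 := by
    rw [measure, StieltjesFunction.measure_Ioi _ (Θ.tendsto_stieltjesFunction_atTop ω),
      ENNReal.ofReal_eq_zero, sub_nonpos]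
    refine ge_of_tendsto ((Θ.mono ω).tendsto_rightLim M.T) ?_
    filter_upwards [self_mem_nhdsWithin] with t ht
    exact (Θ.eq_final ω t ht).ge
  refine measure_mono_null (fun t ht => ?_) (measure_union_null h0 hT)
  by_contra h
  simp only [mem_union, mem_Iio, mem_Ioi, not_or, not_lt] at h
  exact ht h

theorem restrict_measure (Θ : OrderProcess M) (ω : Ω) :
    (Θ.measure ω).restrict (Icc 0 M.T) = Θ.measure ω :=
  Measure.restrict_eq_self_of_ae_mem (mem_ae_iff.2 (Θ.measure_compl_Icc ω))

theorem measure_zero (ω : Ω) : (0 : OrderProcess M).measure ω = 0 := by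
  rw [← Measure.measure_univ_eq_zero, measure_univ]
  exact ENNReal.ofReal_zero

/-- Truncation at a level stops the orders at the time when the level is reached, and so it leaves
fewer orders in every set of times: `Θ` is the sum of its truncation and of the monotone excess
`max (Θ - x) 0`. -/
theorem measure_trunc_le (Θ : OrderProcess M) (x : ℝ) (hx : 0 ≤ x) (ω : Ω) :
    (Θ.trunc x hx).measure ω ≤ Θ.measure ω := by
  have hm : Monotone fun t => max (Θ.cum t ω - x) 0 := fun s t hst =>
    max_le_max (sub_le_sub_right (Θ.mono ω hst) x) le_rfl
  have h : (Θ.mono ω).stieltjesFunction =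
      ((Θ.trunc x hx).mono ω).stieltjesFunction + hm.stieltjesFunction := by
    ext t
    simp only [StieltjesFunction.add_apply, Monotone.stieltjesFunction_eq]
    refine tendsto_nhds_unique ((Θ.mono ω).tendsto_rightLim t) ?_
    refine ((((Θ.trunc x hx).mono ω).tendsto_rightLim t).add (hm.tendsto_rightLim t)).congr ?_
    intro s
    change min (Θ.cum s ω) x + max (Θ.cum s ω - x) 0 = Θ.cum s ω
    rcases le_total (Θ.cum s ω) x with h | h
    · rw [min_eq_left h, max_eq_right (by linarith), add_zero]
    · rw [min_eq_right h, max_eq_left (by linarith), add_sub_cancel]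
  rw [measure, measure, h, StieltjesFunction.measure_add]
  exact Measure.le_add_right le_rfl

theorem cum_measurable (Θ : OrderProcess M) {i : Icc (0 : ℝ) M.T} {t : ℝ} (h : min M.T t ≤ i) :
    Measurable[M.ℱ i] (Θ.cum t) := by
  rcases le_or_gt t 0 with h0 | h0
  · rw [show Θ.cum t = fun _ => 0 from funext fun ω => Θ.eq_zero ω t h0]
    exact measurable_const
  rcases le_or_gt t M.T with hT | hT
  · rw [min_eq_right hT] at h
    exact (Θ.adapted ⟨t, h0.le, hT⟩).mono (M.ℱ.mono h) le_rfl
  · rw [min_eq_left hT.le] at h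
    rw [show Θ.cum t = Θ.final from funext fun ω => Θ.eq_final ω t hT]
    exact Θ.final_measurable.mono (M.ℱ.mono h) le_rfl

theorem measurable_cum (Θ : OrderProcess M) (t : ℝ) : Measurable (Θ.cum t) :=
  (Θ.cum_measurable (i := ⟨M.T, M.T_nonneg, le_rfl⟩) (min_le_left _ _)).mono (M.ℱ.le _) le_rfl

/-- The random measure `dΘ` as a kernel from the sample space to the time axis. -/
noncomputable def kernel (Θ : OrderProcess M) : ProbabilityTheory.Kernel Ω ℝ where
  toFun := Θ.measure
  measurable' := by
    refine .measure_of_isPiSystem ((BorelSpace.measurable_eq (α := ℝ)).trans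
      (borel_eq_generateFrom_Iio ℝ)) isPiSystem_Iio ?_ ?_
    · rintro _ ⟨t, rfl⟩
      simp only [Θ.measure_Iio]
      exact (Θ.measurable_cum t).ennreal_ofReal
    · simp only [Θ.measure_univ]
      exact Θ.measurable_final.ennreal_ofReal

instance (Θ : OrderProcess M) : ProbabilityTheory.IsFiniteKernel Θ.kernel := by
  obtain ⟨C, hC⟩ := Θ.exists_final_le
  exact ⟨ENNReal.ofReal C, ENNReal.ofReal_lt_top, fun ω =>
    (Θ.measure_univ ω).trans_le (ENNReal.ofReal_le_ofReal (hC ω))⟩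

end OrderProcess

/-- Integration by parts for two finite measures on the line: the product of the total masses is
split along the diagonal. -/
theorem integral_real_Iio_add_integral_real_Iic (μ ν : Measure ℝ) [IsFiniteMeasure μ]
    [IsFiniteMeasure ν] :
    ∫ t, μ.real (Iio t) ∂ν + ∫ t, ν.real (Iic t) ∂μ = μ.real univ * ν.real univ := by
  have hm : MeasurableSet {p : ℝ × ℝ | p.1 < p.2} := measurableSet_lt measurable_fst measurable_snd
  have h1 : ∫ t, μ.real (Iio t) ∂ν = (μ.prod ν).real {p | p.1 < p.2} := by
    rw [Measure.real, Measure.prod_apply_symm hm, integral_eq_lintegral_of_nonneg_ae]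
    · congr 1
      refine lintegral_congr fun t => ?_
      rw [ofReal_measureReal]
      rfl
    · exact ae_of_all _ fun t => measureReal_nonneg
    · exact (Monotone.measurable fun s t hst =>
        measureReal_mono (Iio_subset_Iio hst)).aestronglyMeasurable
  have h2 : ∫ t, ν.real (Iic t) ∂μ = (μ.prod ν).real {p | p.1 < p.2}ᶜ := by
    rw [Measure.real, Measure.prod_apply hm.compl, integral_eq_lintegral_of_nonneg_ae]
    · congr 1
      refine lintegral_congr fun t => ?_
      rw [ofReal_measureReal]
      congr 1
      ext s
      simp
    · exact ae_of_all _ fun t => measureReal_nonneg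
    · exact (Monotone.measurable fun s t hst =>
        measureReal_mono (Iic_subset_Iic.2 hst)).aestronglyMeasurable
  rw [h1, h2, measureReal_add_measureReal_compl hm, ← univ_prod_univ, measureReal_prod_prod]

/-! ### Integrals of martingales against order processes -/

/-- The `k`-th point of the grid of mesh `1 / (n + 1)` on `[0, T]`; the grid stays at `T` once it
has arrived there. -/
noncomputable def gridPoint (T : ℝ) (n k : ℕ) : ℝ := min T (k / (n + 1))

theorem gridPoint_mem {T : ℝ} (hT : 0 ≤ T) (n k : ℕ) : gridPoint T n k ∈ Icc 0 T :=
  ⟨le_min hT (by positivity), min_le_left _ _⟩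

/-- The discretization of a path that samples it at the next grid point to the right. -/
noncomputable def sampled (T : ℝ) (f : ℝ → ℝ) (n : ℕ) (t : ℝ) : ℝ :=
  f (gridPoint T n (⌊t * (n + 1)⌋₊ + 1))

theorem tendsto_sampled {T : ℝ} {f : ℝ → ℝ} (hf : IsCadlagOn T f) {t : ℝ} (ht : t ∈ Icc 0 T) :
    Tendsto (fun n => sampled T f n t) atTop (𝓝 (f t)) := by
  refine (hf.1 t ht).tendsto.comp (tendsto_nhdsWithin_iff.2 ⟨?_, Eventually.of_forall fun n => ?_⟩)
  · have h1 : Tendsto (fun n : ℕ => t + 1 / ((n : ℝ) + 1)) atTop (𝓝 t) := by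
      simpa using tendsto_const_nhds.add (tendsto_one_div_add_atTop_nhds_zero_nat (𝕜 := ℝ))
    refine tendsto_of_tendsto_of_tendsto_of_le_of_le tendsto_const_nhds h1 (fun n => ?_) fun n => ?_
    · refine le_min ht.2 ?_
      rw [le_div_iff₀ (by positivity)]
      push_cast
      exact (Nat.lt_floor_add_one _).le
    · refine (min_le_right _ _).trans ?_
      rw [div_le_iff₀ (by positivity), add_mul, one_div_mul_cancel (by positivity)]
      push_cast
      have := Nat.floor_le (a := t * ((n : ℝ) + 1)) (mul_nonneg ht.1 (by positivity))
      linarith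
  · refine ⟨le_min ht.2 ?_, min_le_left _ _⟩
    rw [le_div_iff₀ (by positivity)]
    push_cast
    exact (Nat.lt_floor_add_one _).le

theorem measurable_sampled (T : ℝ) (f : ℝ → ℝ) (n : ℕ) : Measurable (sampled T f n) :=
  (measurable_from_nat (f := fun k => f (gridPoint T n (k + 1)))).comp
    (Nat.measurable_floor.comp (measurable_id.mul_const _))

/-- A càdlàg path that is bounded on the grids is integrable over `[0, T]`. -/
theorem IsCadlagOn.integrableOn {T : ℝ} {f : ℝ → ℝ} (hf : IsCadlagOn T f) {S : ℝ}
    (hS : ∀ n k, |f (gridPoint T n k)| ≤ S) (μ : Measure ℝ) [IsFiniteMeasure μ] :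
    IntegrableOn f (Icc 0 T) μ := by
  have hlim : ∀ᵐ t ∂μ.restrict (Icc 0 T), Tendsto (fun n => sampled T f n t) atTop (𝓝 (f t)) :=
    (ae_restrict_mem measurableSet_Icc).mono fun t ht => tendsto_sampled hf ht
  refine ⟨aestronglyMeasurable_of_tendsto_ae atTop
    (fun n => (measurable_sampled T f n).aestronglyMeasurable) hlim, ?_⟩
  refine HasFiniteIntegral.of_bounded (C := S) (hlim.mono fun t ht => ?_)
  exact le_of_tendsto ht.abs (Eventually.of_forall fun n => hS n _)

theorem IsCadlagOn.tendsto_integral_sampled {T : ℝ} {f : ℝ → ℝ} (hf : IsCadlagOn T f) {S : ℝ}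
    (hS : ∀ n k, |f (gridPoint T n k)| ≤ S) (μ : Measure ℝ) [IsFiniteMeasure μ] :
    Tendsto (fun n => ∫ t in Icc 0 T, sampled T f n t ∂μ) atTop (𝓝 (∫ t in Icc 0 T, f t ∂μ)) :=
  tendsto_integral_of_dominated_convergence (fun _ => S)
    (fun n => (measurable_sampled T f n).aestronglyMeasurable) (integrable_const S)
    (fun n => ae_of_all _ fun _ => hS n _)
    ((ae_restrict_mem measurableSet_Icc).mono fun _ ht => tendsto_sampled hf ht)

section

variable {Ω : Type*} [MeasurableSpace Ω] {P : Measure Ω} {M : DynamicSpreadModel P}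

/-- The integral of the sampled path is a sum over the grid. The orders of `[s, t)` are
`Θ t - Θ s`, and the upper end of the sum only has to lie beyond `T`. -/
theorem OrderProcess.integral_sampled (Θ : OrderProcess M) (f : ℝ → ℝ) (n N : ℕ)
    (hN : M.T * (n + 1) < N) (ω : Ω) :
    ∫ t in Icc 0 M.T, sampled M.T f n t ∂Θ.measure ω =
      ∑ k ∈ Finset.range N, f (gridPoint M.T n (k + 1)) *
        (Θ.cum ((k + 1 : ℕ) / (n + 1)) ω - Θ.cum (k / (n + 1)) ω) := by
  have hn : (0 : ℝ) < n + 1 := by positivity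
  have h : ∀ t ∈ Icc 0 M.T, sampled M.T f n t = ∑ k ∈ Finset.range N,
      (Ico ((k : ℝ) / (n + 1)) ((k + 1 : ℕ) / (n + 1))).indicator
        (fun _ => f (gridPoint M.T n (k + 1))) t := by
    intro t ht
    have h0 : 0 ≤ t * (n + 1) := mul_nonneg ht.1 hn.le
    have hmem : ∀ k : ℕ, t ∈ Ico ((k : ℝ) / (n + 1)) ((k + 1 : ℕ) / (n + 1)) ↔
        ⌊t * (n + 1)⌋₊ = k := by
      intro k
      rw [Nat.floor_eq_iff h0, mem_Ico, div_le_iff₀ hn, lt_div_iff₀ hn]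
      push_cast
      rfl
    rw [Finset.sum_eq_single ⌊t * (n + 1)⌋₊]
    · rw [indicator_of_mem ((hmem _).2 rfl)]
      rfl
    · intro k _ hk
      exact indicator_of_notMem (fun hk' => hk ((hmem k).1 hk').symm) _
    · intro hk
      refine absurd (Finset.mem_range.2 ((Nat.floor_lt h0).2 ?_)) hk
      exact (mul_le_mul_of_nonneg_right ht.2 hn.le).trans_lt hN
  rw [setIntegral_congr_fun measurableSet_Icc h, Θ.restrict_measure, integral_finsetSum]
  · refine Finset.sum_congr rfl fun k _ => ?_
    rw [integral_indicator_const _ measurableSet_Ico, Θ.measure_real_Ico, smul_eq_mul, mul_comm]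
    gcongr
    simp
  · intro k _
    exact (integrable_const _).indicator measurableSet_Ico

variable {Z : ℝ → Ω → ℝ} {z₀ : ℝ}

/-- An `H¹`-martingale is dominated on the grids by an integrable random variable. -/
theorem IsH1Martingale.exists_grid_bound (hZ : IsH1Martingale P M.ℱ Z z₀) :
    ∃ S : Ω → ℝ, Integrable S P ∧ ∀ᵐ ω ∂P, ∀ n k, |Z (gridPoint M.T n k) ω| ≤ S ω := by
  -- The supremum over the grids is measurable, the one over all times need not be.
  set S : Ω → ENNReal := fun ω => ⨆ n : ℕ, ⨆ k : ℕ, ENNReal.ofReal |Z (gridPoint M.T n k) ω|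
  have hmeas : ∀ n k, Measurable fun ω => Z (gridPoint M.T n k) ω := fun n k =>
    ((hZ.martingale.stronglyMeasurable ⟨_, gridPoint_mem M.T_nonneg n k⟩).mono
      (M.ℱ.le _)).measurable
  have hS : Measurable S := Measurable.iSup fun n => Measurable.iSup fun k =>
    (measurable_norm.comp (hmeas n k)).ennreal_ofReal
  have hfin : ∫⁻ ω, S ω ∂P < ⊤ := by
    refine lt_of_le_of_lt (lintegral_mono fun ω => ?_) hZ.sup_integrable
    exact iSup_le fun n => iSup_le fun k => le_iSup
      (fun t : Icc (0 : ℝ) M.T => ENNReal.ofReal |Z t ω|) ⟨_, gridPoint_mem M.T_nonneg n k⟩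
  refine ⟨fun ω => (S ω).toReal, integrable_toReal_of_lintegral_ne_top hS.aemeasurable hfin.ne, ?_⟩
  filter_upwards [ae_lt_top hS hfin.ne] with ω hω n k
  rw [← ENNReal.ofReal_le_iff_le_toReal hω.ne]
  exact le_iSup₂ (f := fun n k : ℕ => ENNReal.ofReal |Z (gridPoint M.T n k) ω|) n k

theorem IsH1Martingale.ae_integrableOn (hZ : IsH1Martingale P M.ℱ Z z₀) (Θ : OrderProcess M) :
    ∀ᵐ ω ∂P, IntegrableOn (fun t => Z t ω) (Icc 0 M.T) (Θ.measure ω) := by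
  obtain ⟨S, -, hS⟩ := hZ.exists_grid_bound
  filter_upwards [hS, hZ.cadlag] with ω h1 h2 using h2.integrableOn h1 _

theorem IsH1Martingale.integrable_mul (hZ : IsH1Martingale P M.ℱ Z z₀) (i : Icc (0 : ℝ) M.T)
    {Y : Ω → ℝ} (hY : Measurable Y) {C : ℝ} (hC : ∀ ω, |Y ω| ≤ C) :
    Integrable (fun ω => Z i ω * Y ω) P :=
  (hZ.martingale.integrable i).mul_bdd hY.aestronglyMeasurable (ae_of_all _ hC)

variable [IsProbabilityMeasure P]

theorem IsH1Martingale.integral_mul (hZ : IsH1Martingale P M.ℱ Z z₀) {i j : Icc (0 : ℝ) M.T}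
    (hij : i ≤ j) {Y : Ω → ℝ} (hY : Measurable[M.ℱ i] Y) {C : ℝ} (hC : ∀ ω, |Y ω| ≤ C) :
    ∫ ω, Z i ω * Y ω ∂P = ∫ ω, Z j ω * Y ω ∂P := by
  have hY' : Measurable Y := hY.mono (M.ℱ.le i) le_rfl
  rw [← integral_condExp (M.ℱ.le i) (f := fun ω => Z j ω * Y ω)]
  refine integral_congr_ae ?_
  have h := condExp_mul_of_stronglyMeasurable_right (m := M.ℱ i) hY.stronglyMeasurable
    (hZ.integrable_mul j hY' hC) (hZ.martingale.integrable j)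
  filter_upwards [h, hZ.martingale.condExp_ae_eq hij] with ω h1 h2
  refine Eq.trans ?_ h1.symm
  rw [Pi.mul_apply, h2]

/-- The expected integral of the sampled martingale telescopes, because each increment of `Θ` is
known at the grid point where the martingale is sampled. -/
theorem IsH1Martingale.integral_integral_sampled (hZ : IsH1Martingale P M.ℱ Z z₀)
    (Θ : OrderProcess M) (n : ℕ) :
    AEStronglyMeasurable
        (fun ω => ∫ t in Icc 0 M.T, sampled M.T (fun t => Z t ω) n t ∂Θ.measure ω) P ∧
      ∫ ω, (∫ t in Icc 0 M.T, sampled M.T (fun t => Z t ω) n t ∂Θ.measure ω) ∂P =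
        ∫ ω, Z M.T ω * Θ.final ω ∂P := by
  obtain ⟨C, hC⟩ := Θ.exists_final_le
  obtain ⟨N, hN⟩ := exists_nat_gt (M.T * (n + 1))
  have hn : (0 : ℝ) < n + 1 := by positivity
  have hY : ∀ k : ℕ, Measurable fun ω =>
      Θ.cum ((k + 1 : ℕ) / (n + 1)) ω - Θ.cum (k / (n + 1)) ω := fun k =>
    (Θ.measurable_cum _).sub (Θ.measurable_cum _)
  have hYC : ∀ (k : ℕ) ω, |Θ.cum ((k + 1 : ℕ) / (n + 1)) ω - Θ.cum (k / (n + 1)) ω| ≤ C := by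
    intro k ω
    have h1 := Θ.cum_nonneg ((k + 1 : ℕ) / (n + 1)) ω
    have h2 := Θ.cum_nonneg (k / (n + 1)) ω
    have h3 := (Θ.cum_le_final ((k + 1 : ℕ) / (n + 1)) ω).trans (hC ω)
    have h4 := (Θ.cum_le_final (k / (n + 1)) ω).trans (hC ω)
    rw [abs_le]
    constructor <;> linarith
  have hint : ∀ (i : Icc (0 : ℝ) M.T) (k : ℕ), Integrable (fun ω => Z i ω *
      (Θ.cum ((k + 1 : ℕ) / (n + 1)) ω - Θ.cum (k / (n + 1)) ω)) P := fun i k =>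
    hZ.integrable_mul i (hY k) (hYC k)
  simp only [Θ.integral_sampled _ n N hN]
  constructor
  · exact Finset.aestronglyMeasurable_fun_sum _ fun k _ =>
      (hint ⟨_, gridPoint_mem M.T_nonneg n (k + 1)⟩ k).aestronglyMeasurable
  rw [integral_finsetSum _ fun k _ => hint ⟨_, gridPoint_mem M.T_nonneg n (k + 1)⟩ k]
  have hmart : ∀ k : ℕ, ∫ ω, Z (gridPoint M.T n (k + 1)) ω *
      (Θ.cum ((k + 1 : ℕ) / (n + 1)) ω - Θ.cum (k / (n + 1)) ω) ∂P =
      ∫ ω, Z M.T ω * (Θ.cum ((k + 1 : ℕ) / (n + 1)) ω - Θ.cum (k / (n + 1)) ω) ∂P := by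
    intro k
    refine hZ.integral_mul (i := ⟨_, gridPoint_mem M.T_nonneg n (k + 1)⟩)
      (j := ⟨M.T, M.T_nonneg, le_rfl⟩) (gridPoint_mem M.T_nonneg n (k + 1)).2 ?_ (hYC k)
    refine (Θ.cum_measurable le_rfl).sub (Θ.cum_measurable (min_le_min_left _ ?_))
    gcongr
    simp
  simp only [hmart]
  rw [← integral_finsetSum _ fun k _ => hint ⟨M.T, M.T_nonneg, le_rfl⟩ k]
  refine integral_congr_ae (ae_of_all _ fun ω => ?_)
  simp only
  rw [← Finset.mul_sum, Finset.sum_range_sub (fun k : ℕ => Θ.cum (k / (n + 1)) ω) N,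
    Θ.eq_final ω _ ((lt_div_iff₀ hn).2 hN), Θ.eq_zero ω _ (by simp), sub_zero]

/-- The expected integral of a martingale against an adapted increasing process of bounded total
mass is the expectation of the product of the terminal values. -/
theorem IsH1Martingale.integral_integral (hZ : IsH1Martingale P M.ℱ Z z₀) (Θ : OrderProcess M) :
    Integrable (fun ω => ∫ t in Icc 0 M.T, Z t ω ∂Θ.measure ω) P ∧
      ∫ ω, (∫ t in Icc 0 M.T, Z t ω ∂Θ.measure ω) ∂P = ∫ ω, Z M.T ω * Θ.final ω ∂P := by
  obtain ⟨S, hSint, hS⟩ := hZ.exists_grid_bound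
  obtain ⟨C, hC⟩ := Θ.exists_final_le
  have hlim : ∀ᵐ ω ∂P, Tendsto
      (fun n => ∫ t in Icc 0 M.T, sampled M.T (fun t => Z t ω) n t ∂Θ.measure ω) atTop
      (𝓝 (∫ t in Icc 0 M.T, Z t ω ∂Θ.measure ω)) := by
    filter_upwards [hS, hZ.cadlag] with ω h1 h2 using h2.tendsto_integral_sampled h1 _
  have hbound : ∀ n, ∀ᵐ ω ∂P,
      ‖∫ t in Icc 0 M.T, sampled M.T (fun t => Z t ω) n t ∂Θ.measure ω‖ ≤ S ω * C := by
    intro n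
    filter_upwards [hS] with ω h1
    rw [Θ.restrict_measure]
    refine (norm_integral_le_of_norm_le_const (ae_of_all _ fun t => h1 n _)).trans ?_
    rw [Θ.measure_real_univ]
    exact mul_le_mul_of_nonneg_left (hC ω) ((abs_nonneg _).trans (h1 0 0))
  have hmeas := fun n => (hZ.integral_integral_sampled Θ n).1
  constructor
  · refine (hSint.mul_const C).mono' (aestronglyMeasurable_of_tendsto_ae atTop hmeas hlim) ?_
    filter_upwards [hlim, ae_all_iff.2 hbound] with ω h1 h2
    exact le_of_tendsto h1.norm (Eventually.of_forall h2)
  · refine tendsto_nhds_unique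
      (tendsto_integral_of_dominated_convergence _ hmeas (hSint.mul_const C) hbound hlim) ?_
    simp only [(hZ.integral_integral_sampled Θ _).2]
    exact tendsto_const_nhds

theorem IsH1Martingale.integral_terminal (hZ : IsH1Martingale P M.ℱ Z z₀) :
    ∫ ω, Z M.T ω ∂P = z₀ := by
  have h := hZ.integral_mul (i := ⟨0, le_rfl, M.T_nonneg⟩) (j := ⟨M.T, M.T_nonneg, le_rfl⟩)
    M.T_nonneg (Y := fun _ => 1) measurable_const (C := 1) (by simp)
  simp only [mul_one] at h
  rw [← h, integral_congr_ae hZ.start]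
  simp

end

/-! ### Bounded measurable integrands -/

/-- The pairs `(s, t)` of times with `0 ≤ s ≤ t ≤ T`. -/
def timeTriangle (T : ℝ) : Set (ℝ × ℝ) := {p | 0 ≤ p.1 ∧ p.1 ≤ p.2 ∧ p.2 ≤ T}

/-- A function of two times that is bounded and Borel on the triangle `0 ≤ s ≤ t ≤ T`. -/
structure IsBoundedOnTriangle (T : ℝ) (G : ℝ → ℝ → ℝ) : Prop where
  measurable : Measurable ((timeTriangle T).indicator (Function.uncurry G))
  bounded : ∃ C, ∀ s t, 0 ≤ s → s ≤ t → t ≤ T → |G s t| ≤ C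

theorem measurableSet_timeTriangle (T : ℝ) : MeasurableSet (timeTriangle T) :=
  (measurableSet_le measurable_const measurable_fst).inter
    ((measurableSet_le measurable_fst measurable_snd).inter
      (measurableSet_le measurable_snd measurable_const))

namespace IsBoundedOnTriangle

variable {T : ℝ} {G H : ℝ → ℝ → ℝ}

theorem of_eqOn (hH : Measurable (Function.uncurry H))
    (h : ∀ s t, 0 ≤ s → s ≤ t → t ≤ T → G s t = H s t)
    (hb : ∃ C, ∀ s t, 0 ≤ s → s ≤ t → t ≤ T → |G s t| ≤ C) : IsBoundedOnTriangle T G where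
  measurable := by
    have h' : EqOn (Function.uncurry G) (Function.uncurry H) (timeTriangle T) :=
      fun p hp => h p.1 p.2 hp.1 hp.2.1 hp.2.2
    rw [indicator_congr h']
    exact hH.indicator (measurableSet_timeTriangle T)
  bounded := hb

theorem integrableOn (hG : IsBoundedOnTriangle T G) {t : ℝ} (ht : t ≤ T) (μ : Measure ℝ)
    [IsFiniteMeasure μ] : IntegrableOn (fun s => G s t) (Ico 0 t) μ := by
  obtain ⟨C, hC⟩ := hG.bounded
  have hm := hG.measurable.comp (measurable_prodMk_right (y := t))
  refine IntegrableOn.congr_fun (f := fun s => (timeTriangle T).indicator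
    (Function.uncurry G) (s, t)) ⟨hm.aestronglyMeasurable, ?_⟩ ?_ measurableSet_Ico
  · refine HasFiniteIntegral.of_bounded (C := C) ?_
    filter_upwards [ae_restrict_mem measurableSet_Ico] with s hs
    rw [indicator_of_mem (show (s, t) ∈ timeTriangle _ from ⟨hs.1, hs.2.le, ht⟩)]
    exact hC s t hs.1 hs.2.le ht
  · intro s hs
    exact indicator_of_mem (show (s, t) ∈ timeTriangle _ from ⟨hs.1, hs.2.le, ht⟩) _

end IsBoundedOnTriangle

namespace DynamicSpreadModel

variable {Ω : Type*} [MeasurableSpace Ω] {P : Measure Ω} {M : DynamicSpreadModel P}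

/-- A random function of time that is uniformly bounded and jointly measurable on `[0, T]`. Nothing
is asked outside `[0, T]`, where `K` and `ρ` are arbitrary. -/
structure IsBoundedMeasurable (M : DynamicSpreadModel P) (F : ℝ → Ω → ℝ) : Prop where
  measurable : Measurable fun p : Ω × ℝ => (Icc 0 M.T).indicator (fun t => F t p.1) p.2
  bounded : ∃ C, ∀ ω, ∀ t ∈ Icc 0 M.T, |F t ω| ≤ C

namespace IsBoundedMeasurable

variable {F G : ℝ → Ω → ℝ}

theorem add (hF : M.IsBoundedMeasurable F) (hG : M.IsBoundedMeasurable G) :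
    M.IsBoundedMeasurable fun t ω => F t ω + G t ω where
  measurable := by
    simp only [indicator_add]
    exact hF.measurable.add hG.measurable
  bounded := by
    obtain ⟨C, hC⟩ := hF.bounded
    obtain ⟨C', hC'⟩ := hG.bounded
    exact ⟨C + C', fun ω t ht => (abs_add_le _ _).trans (add_le_add (hC ω t ht) (hC' ω t ht))⟩

theorem mul (hF : M.IsBoundedMeasurable F) (hG : M.IsBoundedMeasurable G) :
    M.IsBoundedMeasurable fun t ω => F t ω * G t ω where
  measurable := by
    simp only [indicator_mul]
    exact hF.measurable.mul hG.measurable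
  bounded := by
    obtain ⟨C, hC⟩ := hF.bounded
    obtain ⟨C', hC'⟩ := hG.bounded
    refine ⟨C * C', fun ω t ht => (abs_mul _ _).trans_le ?_⟩
    exact mul_le_mul (hC ω t ht) (hC' ω t ht) (abs_nonneg _) ((abs_nonneg _).trans (hC ω t ht))

theorem of_eqOn {H : ℝ → Ω → ℝ} (hH : Measurable fun p : Ω × ℝ => H p.2 p.1)
    (h : ∀ ω, ∀ t ∈ Icc 0 M.T, F t ω = H t ω) (hb : ∃ C, ∀ ω, ∀ t ∈ Icc 0 M.T, |F t ω| ≤ C) :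
    M.IsBoundedMeasurable F where
  measurable := by
    have : (fun p : Ω × ℝ => (Icc 0 M.T).indicator (fun t => F t p.1) p.2) =
        (Prod.snd ⁻¹' Icc 0 M.T).indicator fun p => H p.2 p.1 := by
      ext p
      by_cases hp : p.2 ∈ Icc 0 M.T
      · rw [indicator_of_mem hp, indicator_of_mem (by exact hp), h _ _ hp]
      · rw [indicator_of_notMem hp, indicator_of_notMem (by exact hp)]
    rw [this]
    exact hH.indicator (measurable_snd measurableSet_Icc)
  bounded := hb

theorem const (c : ℝ) : M.IsBoundedMeasurable fun _ _ => c :=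
  of_eqOn (H := fun _ _ => c) measurable_const (fun _ _ _ => rfl) ⟨|c|, fun _ _ _ => le_rfl⟩

theorem integrableOn (hF : M.IsBoundedMeasurable F) (ω : Ω) (μ : Measure ℝ) [IsFiniteMeasure μ] :
    IntegrableOn (fun t => F t ω) (Icc 0 M.T) μ := by
  obtain ⟨C, hC⟩ := hF.bounded
  have hm := hF.measurable.comp (measurable_prodMk_left (x := ω))
  rw [← integrable_indicator_iff measurableSet_Icc]
  refine ⟨hm.aestronglyMeasurable, HasFiniteIntegral.of_bounded (C := max C 0) ?_⟩
  refine ae_of_all _ fun t => ?_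
  by_cases ht : t ∈ Icc 0 M.T
  · rw [indicator_of_mem ht]
    exact (hC ω t ht).trans (le_max_left _ _)
  · rw [indicator_of_notMem ht, norm_zero]
    exact le_max_right _ _

theorem integrable_integral [IsFiniteMeasure P] (hF : M.IsBoundedMeasurable F)
    (Θ : OrderProcess M) :
    Integrable (fun ω => ∫ t in Icc 0 M.T, F t ω ∂Θ.measure ω) P := by
  obtain ⟨C, hC⟩ := hF.bounded
  obtain ⟨C', hC'⟩ := Θ.exists_final_le
  refine ⟨?_, HasFiniteIntegral.of_bounded (C := max C 0 * C') (ae_of_all _ fun ω => ?_)⟩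
  · have h := hF.measurable.stronglyMeasurable.integral_kernel_prod_right' (κ := Θ.kernel)
    simp only [integral_indicator measurableSet_Icc] at h
    exact h.aestronglyMeasurable
  · have h : ∀ᵐ t ∂(Θ.measure ω).restrict (Icc 0 M.T), ‖F t ω‖ ≤ max C 0 :=
      (ae_restrict_mem measurableSet_Icc).mono fun t ht => (hC ω t ht).trans (le_max_left _ _)
    refine (norm_integral_le_of_norm_le_const h).trans ?_
    rw [Θ.restrict_measure, Θ.measure_real_univ]
    exact mul_le_mul_of_nonneg_left (hC' ω) (le_max_right _ _)

end IsBoundedMeasurable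

theorem measurable_integral_measure {G : ℝ × ℝ → ℝ} (hG : Measurable G) (Θ : OrderProcess M) :
    Measurable fun p : Ω × ℝ => ∫ s, G (s, p.2) ∂Θ.measure p.1 := by
  have h : Measurable fun q : (Ω × ℝ) × ℝ => G (q.2, q.1.2) :=
    hG.comp (measurable_snd.prodMk measurable_fst.snd)
  exact (h.stronglyMeasurable.integral_kernel_prod_right'
    (κ := Θ.kernel.comap Prod.fst measurable_fst)).measurable

theorem isBoundedMeasurable_integral {G : ℝ → ℝ → ℝ} (hG : IsBoundedOnTriangle M.T G)
    (Θ : OrderProcess M) :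
    M.IsBoundedMeasurable fun t ω => ∫ s in Ico 0 t, G s t ∂Θ.measure ω := by
  have hm : MeasurableSet {p : ℝ × ℝ | 0 ≤ p.1 ∧ p.1 < p.2} :=
    (measurableSet_le measurable_const measurable_fst).inter
      (measurableSet_lt measurable_fst measurable_snd)
  refine .of_eqOn (H := fun t ω => ∫ s, {p : ℝ × ℝ | 0 ≤ p.1 ∧ p.1 < p.2}.indicator
    ((timeTriangle M.T).indicator (Function.uncurry G)) (s, t) ∂Θ.measure ω)
    (measurable_integral_measure (hG.measurable.indicator hm) Θ) (fun ω t ht => ?_) ?_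
  · rw [← integral_indicator measurableSet_Ico]
    congr 1
    ext s
    by_cases hs : s ∈ Ico 0 t
    · rw [indicator_of_mem hs,
        indicator_of_mem (show (s, t) ∈ {p : ℝ × ℝ | 0 ≤ p.1 ∧ p.1 < p.2} from hs),
        indicator_of_mem (show (s, t) ∈ timeTriangle _ from ⟨hs.1, hs.2.le, ht.2⟩)]
      rfl
    · rw [indicator_of_notMem hs, indicator_of_notMem
        (show (s, t) ∉ {p : ℝ × ℝ | 0 ≤ p.1 ∧ p.1 < p.2} from hs)]
  · obtain ⟨C, hC⟩ := hG.bounded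
    obtain ⟨C', hC'⟩ := Θ.exists_final_le
    refine ⟨max C 0 * C', fun ω t ht => ?_⟩
    have h : ∀ᵐ s ∂(Θ.measure ω).restrict (Ico 0 t), ‖G s t‖ ≤ max C 0 :=
      (ae_restrict_mem measurableSet_Ico).mono fun s hs =>
        (hC s t hs.1 hs.2.le ht.2).trans (le_max_left _ _)
    refine (norm_integral_le_of_norm_le_const h).trans ?_
    refine mul_le_mul_of_nonneg_left ?_ (le_max_right _ _)
    refine le_trans ?_ (hC' ω)
    rw [← Θ.measure_real_univ, measureReal_restrict_apply_univ]
    exact measureReal_mono (subset_univ _)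

theorem isBoundedMeasurable_cum (Θ : OrderProcess M) : M.IsBoundedMeasurable Θ.cum := by
  have h := isBoundedMeasurable_integral (G := fun _ _ => 1) (.of_eqOn (H := fun _ _ => 1)
    measurable_const (fun _ _ _ _ _ => rfl) ⟨1, fun _ _ _ _ _ => by simp⟩) Θ
  have h2 : ∀ ω, ∀ t ∈ Icc 0 M.T, ∫ s in Ico 0 t, (1 : ℝ) ∂Θ.measure ω = Θ.cum t ω := by
    intro ω t ht
    rw [setIntegral_const, Θ.measure_real_Ico ht.1, Θ.eq_zero ω 0 le_rfl]
    simp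
  constructor
  · convert! h.measurable using 2 with p
    exact indicator_congr (fun t ht => (h2 p.1 t ht).symm) ▸ rfl
  · obtain ⟨C, hC⟩ := h.bounded
    exact ⟨C, fun ω t ht => h2 ω t ht ▸ hC ω t ht⟩

theorem isBoundedMeasurable_jump (Θ : OrderProcess M) : M.IsBoundedMeasurable Θ.jump := by
  refine .of_eqOn (H := fun t ω => ∫ s, {p : ℝ × ℝ | p.1 = p.2}.indicator 1 (s, t) ∂Θ.measure ω)
    (measurable_integral_measure (G := {p : ℝ × ℝ | p.1 = p.2}.indicator 1)
    (measurable_one.indicator (measurableSet_eq_fun measurable_fst measurable_snd)) Θ)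
    (fun ω t _ => ?_) ?_
  · rw [← Θ.measure_real_singleton, ← integral_indicator_one (measurableSet_singleton t)]
    rfl
  · obtain ⟨C, hC⟩ := Θ.exists_final_le
    refine ⟨C, fun ω t _ => ?_⟩
    rw [← Θ.measure_real_singleton, abs_of_nonneg measureReal_nonneg]
    exact (measureReal_mono (subset_univ _)).trans ((Θ.measure_real_univ ω).trans_le (hC ω))

theorem measurable_indicator_K : Measurable ((Icc 0 M.T).indicator M.K) := by
  refine measurable_of_restrict_of_restrict_compl (s := Icc 0 M.T) measurableSet_Icc ?_ ?_
  · convert! M.K_borel using 1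
    ext t
    exact indicator_of_mem t.2 _
  · convert! measurable_const (a := (0 : ℝ)) using 1
    ext t
    exact indicator_of_notMem t.2 _

theorem isBoundedMeasurable_K : M.IsBoundedMeasurable fun t _ => M.K t where
  measurable := M.measurable_indicator_K.comp measurable_snd
  bounded := by
    obtain ⟨C, hC⟩ := M.K_bounded
    exact ⟨C, fun _ t ht => (abs_of_pos (M.K_pos t ht)).trans_le (hC t ht)⟩

end DynamicSpreadModel

/-! ### Resilience and the decomposition of the costs -/

namespace DynamicSpreadModel

variable {Ω : Type*} [MeasurableSpace Ω] {P : Measure Ω} {M : DynamicSpreadModel P}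

theorem decay_nonneg (s t : ℝ) : 0 ≤ M.decay s t := (Real.exp_pos _).le

theorem decay_le_one {s t : ℝ} (hs : 0 ≤ s) (hst : s ≤ t) (ht : t ≤ M.T) : M.decay s t ≤ 1 := by
  rw [decay, Real.exp_le_one_iff, neg_nonpos]
  exact intervalIntegral.integral_nonneg hst fun u hu =>
    (M.ρ_pos u ⟨hs.trans hu.1, hu.2.trans ht⟩).le

/-- On `[0, T]` the resilience is the increment of a continuous function. -/
theorem exists_decay_eq : ∃ R : ℝ → ℝ, Continuous R ∧
    ∀ s t, 0 ≤ s → s ≤ t → t ≤ M.T → M.decay s t = Real.exp (-(R t - R s)) := by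
  have hρ : Integrable ((Icc 0 M.T).indicator M.ρ) :=
    (integrable_indicator_iff measurableSet_Icc).2 M.ρ_integrable
  refine ⟨fun t => ∫ u in (0 : ℝ)..t, (Icc 0 M.T).indicator M.ρ u,
    intervalIntegral.continuous_primitive (fun a b => hρ.intervalIntegrable) 0, ?_⟩
  intro s t hs hst ht
  rw [intervalIntegral.integral_interval_sub_left hρ.intervalIntegrable hρ.intervalIntegrable,
    decay]
  congr 2
  refine intervalIntegral.integral_congr fun u hu => ?_
  rw [uIcc_of_le hst] at hu
  exact (indicator_of_mem (show u ∈ Icc 0 M.T from ⟨hs.trans hu.1, hu.2.trans ht⟩) _).symm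

theorem isBoundedOnTriangle_decay : IsBoundedOnTriangle M.T M.decay := by
  obtain ⟨R, hR, h⟩ := M.exists_decay_eq
  refine .of_eqOn (H := fun s t => Real.exp (-(R t - R s))) ?_ h ⟨1, fun s t hs hst ht => ?_⟩
  · have : Continuous (Function.uncurry fun s t => Real.exp (-(R t - R s))) := by
      unfold Function.uncurry
      fun_prop
    exact this.measurable
  · rw [abs_of_nonneg (decay_nonneg s t)]
    exact decay_le_one hs hst ht

theorem isBoundedOnTriangle_one_sub_decay :
    IsBoundedOnTriangle M.T fun s t => 1 - M.decay s t where
  measurable := by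
    have h := (measurable_one.indicator (measurableSet_timeTriangle M.T)).sub
      M.isBoundedOnTriangle_decay.measurable
    convert! h using 1
    exact indicator_sub _ 1 (Function.uncurry M.decay)
  bounded := ⟨1, fun s t hs hst ht => by
    have h1 := M.decay_nonneg s t
    have h2 := M.decay_le_one hs hst ht
    rw [abs_le]
    constructor <;> linarith⟩

theorem isBoundedOnTriangle_K_mul_decay :
    IsBoundedOnTriangle M.T fun s t => M.K s * M.decay s t where
  measurable := by
    convert! (M.measurable_indicator_K.comp measurable_fst).mul
      M.isBoundedOnTriangle_decay.measurable using 1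
    ext p
    by_cases hp : p ∈ timeTriangle M.T
    · rw [indicator_of_mem hp, Pi.mul_apply, indicator_of_mem hp, Function.comp_apply,
        indicator_of_mem (show p.1 ∈ Icc 0 M.T from ⟨hp.1, hp.2.1.trans hp.2.2⟩)]
      rfl
    · rw [indicator_of_notMem hp, Pi.mul_apply, indicator_of_notMem hp, mul_zero]
  bounded := by
    obtain ⟨C, hC⟩ := M.K_bounded
    refine ⟨C, fun s t hs hst ht => ?_⟩
    have hK := M.K_pos s ⟨hs, hst.trans ht⟩
    rw [abs_mul, abs_of_pos hK, abs_of_nonneg (decay_nonneg s t)]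
    exact (mul_le_of_le_one_right hK.le (decay_le_one hs hst ht)).trans (hC s ⟨hs, hst.trans ht⟩)

theorem isBoundedMeasurable_tempImpact (d₀ : ℝ) (Θ : OrderProcess M) :
    M.IsBoundedMeasurable (M.tempImpact d₀ Θ) := by
  obtain ⟨R, hR, h⟩ := M.exists_decay_eq
  have hd : M.IsBoundedMeasurable fun t _ => M.decay 0 t := by
    refine .of_eqOn (H := fun t _ => Real.exp (-(R t - R 0))) ?_
      (fun ω t ht => h 0 t le_rfl ht.1 ht.2) ⟨1, fun ω t ht => ?_⟩
    · have : Continuous fun t => Real.exp (-(R t - R 0)) := by fun_prop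
      exact this.measurable.comp measurable_snd
    · rw [abs_of_nonneg (decay_nonneg 0 t)]
      exact decay_le_one le_rfl ht.1 ht.2
  exact ((IsBoundedMeasurable.const d₀).mul hd).add
    (isBoundedMeasurable_integral isBoundedOnTriangle_K_mul_decay Θ)

theorem isBoundedMeasurable_temp_add_jump (d₀ : ℝ) (Θ : OrderProcess M) :
    M.IsBoundedMeasurable fun t ω => M.tempImpact d₀ Θ t ω + M.K t / 2 * Θ.jump t ω := by
  have h := (M.isBoundedMeasurable_tempImpact d₀ Θ).add
    ((M.isBoundedMeasurable_K.mul (.const (1 / 2))).mul (isBoundedMeasurable_jump Θ))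
  simpa only [mul_one_div] using h

theorem integrable_tempCost [IsFiniteMeasure P] (d₀ : ℝ) (Θ : OrderProcess M) :
    Integrable (M.tempCost d₀ Θ) P :=
  (M.isBoundedMeasurable_temp_add_jump d₀ Θ).integrable_integral Θ

/-- The reduction of the costs of the orders `Θ` that is due to the permanent impact of the orders
`Ψ` on the opposite side, for `γ = 1`. -/
noncomputable def crossImpact (M : DynamicSpreadModel P) (Θ Ψ : OrderProcess M) (ω : Ω) : ℝ :=
  ∫ t in Icc 0 M.T, (∫ s in Ico 0 t, (1 - M.decay s t) ∂Ψ.measure ω) ∂Θ.measure ω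

theorem isBoundedMeasurable_one_sub_decay (Ψ : OrderProcess M) :
    M.IsBoundedMeasurable fun t ω => ∫ s in Ico 0 t, (1 - M.decay s t) ∂Ψ.measure ω :=
  isBoundedMeasurable_integral isBoundedOnTriangle_one_sub_decay Ψ

theorem integral_cum_add_jump (Θ : OrderProcess M) (ω : Ω) :
    ∫ t in Icc 0 M.T, (Θ.cum t ω + Θ.jump t ω / 2) ∂Θ.measure ω = Θ.final ω ^ 2 / 2 := by
  have h := integral_real_Iio_add_integral_real_Iic (Θ.measure ω) (Θ.measure ω)
  have h1 := (isBoundedMeasurable_cum Θ).integrableOn ω (Θ.measure ω)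
  have h2 := (isBoundedMeasurable_jump Θ).integrableOn ω (Θ.measure ω)
  rw [IntegrableOn, Θ.restrict_measure] at h1 h2
  simp only [Θ.measure_real_Iio, Θ.measure_real_Iic, Θ.measure_real_univ] at h
  rw [integral_add h1 h2] at h
  rw [Θ.restrict_measure, integral_add h1 (h2.div_const 2), integral_div]
  linarith

theorem crossImpact_add_le (Θ Ψ : OrderProcess M) (ω : Ω) :
    M.crossImpact Θ Ψ ω + M.crossImpact Ψ Θ ω ≤ Θ.final ω * Ψ.final ω := by
  have hle : ∀ (Θ Ψ : OrderProcess M), M.crossImpact Θ Ψ ω ≤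
      ∫ t in Icc 0 M.T, Ψ.cum t ω ∂Θ.measure ω := by
    intro Θ Ψ
    refine setIntegral_mono_on ((isBoundedMeasurable_one_sub_decay Ψ).integrableOn ω _)
      ((isBoundedMeasurable_cum Ψ).integrableOn ω _) measurableSet_Icc fun t ht => ?_
    calc ∫ s in Ico 0 t, (1 - M.decay s t) ∂Ψ.measure ω
        ≤ ∫ s in Ico 0 t, (1 : ℝ) ∂Ψ.measure ω :=
          setIntegral_mono_on (isBoundedOnTriangle_one_sub_decay.integrableOn ht.2 _)
            (integrable_const _) measurableSet_Ico fun s _ => sub_le_self _ (decay_nonneg s t)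
      _ = Ψ.cum t ω := by
          rw [setIntegral_const, Ψ.measure_real_Ico ht.1, Ψ.eq_zero ω 0 le_rfl]
          simp
  have h := integral_real_Iio_add_integral_real_Iic (Θ.measure ω) (Ψ.measure ω)
  simp only [Θ.measure_real_Iio, Ψ.measure_real_Iic, Θ.measure_real_univ,
    Ψ.measure_real_univ] at h
  have h1 := (isBoundedMeasurable_cum Ψ).integrableOn ω (Θ.measure ω)
  have h2 := (isBoundedMeasurable_jump Ψ).integrableOn ω (Θ.measure ω)
  rw [IntegrableOn, Θ.restrict_measure] at h1 h2
  have h3 : ∫ t, Ψ.cum t ω ∂Θ.measure ω ≤ ∫ t, (Ψ.cum t ω + Ψ.jump t ω) ∂Θ.measure ω :=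
    integral_mono h1 (h1.add h2) fun t => le_add_of_nonneg_right
      (Ψ.measure_real_singleton t ω ▸ measureReal_nonneg)
  have h4 := hle Θ Ψ
  have h5 := hle Ψ Θ
  rw [Θ.restrict_measure] at h4
  rw [Ψ.restrict_measure] at h5
  linarith

theorem impact_eq (d₀ : ℝ) (Θ Ψ : OrderProcess M) {t : ℝ} (ht : t ∈ Icc 0 M.T) (ω : Ω) :
    M.impact d₀ Θ Ψ t ω = M.tempImpact d₀ Θ t ω + M.γ * Θ.cum t ω
      - M.γ * ∫ s in Ico 0 t, (1 - M.decay s t) ∂Ψ.measure ω := by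
  rw [impact, tempImpact, integral_add (integrable_const _)
    (isBoundedOnTriangle_K_mul_decay.integrableOn ht.2 _), setIntegral_const,
    Θ.measure_real_Ico ht.1, Θ.eq_zero ω 0 le_rfl, integral_const_mul, smul_eq_mul]
  ring

theorem isBoundedMeasurable_impact_add_jump (d₀ : ℝ) (Θ Ψ : OrderProcess M) :
    M.IsBoundedMeasurable fun t ω => M.tempImpact d₀ Θ t ω + M.K t / 2 * Θ.jump t ω
      + M.γ * (Θ.cum t ω + Θ.jump t ω * (1 / 2))
      + -M.γ * ∫ s in Ico 0 t, (1 - M.decay s t) ∂Ψ.measure ω :=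
  ((isBoundedMeasurable_temp_add_jump d₀ Θ).add ((IsBoundedMeasurable.const M.γ).mul
    ((isBoundedMeasurable_cum Θ).add
      ((isBoundedMeasurable_jump Θ).mul (IsBoundedMeasurable.const (1 / 2)))))).add
    ((IsBoundedMeasurable.const (-M.γ)).mul (isBoundedMeasurable_one_sub_decay Ψ))

theorem impact_add_jump_eq (d₀ : ℝ) (Θ Ψ : OrderProcess M) {t : ℝ} (ht : t ∈ Icc 0 M.T) (ω : Ω) :
    M.impact d₀ Θ Ψ t ω + Θ.jump t ω / (2 * M.q t) =
      M.tempImpact d₀ Θ t ω + M.K t / 2 * Θ.jump t ω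
      + M.γ * (Θ.cum t ω + Θ.jump t ω * (1 / 2))
      + -M.γ * ∫ s in Ico 0 t, (1 - M.decay s t) ∂Ψ.measure ω := by
  rw [impact_eq d₀ Θ Ψ ht, q, mul_one_div, div_div_eq_mul_div]
  ring

theorem integrableOn_impact_add_jump (d₀ : ℝ) (Θ Ψ : OrderProcess M) (ω : Ω) (μ : Measure ℝ)
    [IsFiniteMeasure μ] : IntegrableOn
      (fun t => M.impact d₀ Θ Ψ t ω + Θ.jump t ω / (2 * M.q t)) (Icc 0 M.T) μ :=
  ((isBoundedMeasurable_impact_add_jump d₀ Θ Ψ).integrableOn ω μ).congr_fun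
    (fun _ ht => (impact_add_jump_eq d₀ Θ Ψ ht ω).symm) measurableSet_Icc

theorem integrable_integral_impact_add_jump [IsFiniteMeasure P] (d₀ : ℝ) (Θ Ψ : OrderProcess M) :
    Integrable (fun ω => ∫ t in Icc 0 M.T,
      (M.impact d₀ Θ Ψ t ω + Θ.jump t ω / (2 * M.q t)) ∂Θ.measure ω) P :=
  ((isBoundedMeasurable_impact_add_jump d₀ Θ Ψ).integrable_integral Θ).congr
    (ae_of_all _ fun ω => setIntegral_congr_fun measurableSet_Icc
      fun _ ht => (impact_add_jump_eq d₀ Θ Ψ ht ω).symm)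

/-- The impact costs of one side of the book: temporary costs, own permanent impact, and the
reduction by the permanent impact of the other side. -/
theorem integral_impact_add_jump (d₀ : ℝ) (Θ Ψ : OrderProcess M) (ω : Ω) :
    ∫ t in Icc 0 M.T, (M.impact d₀ Θ Ψ t ω + Θ.jump t ω / (2 * M.q t)) ∂Θ.measure ω =
      M.tempCost d₀ Θ ω + M.γ * (Θ.final ω ^ 2 / 2) - M.γ * M.crossImpact Θ Ψ ω := by
  have h1 := (isBoundedMeasurable_temp_add_jump d₀ Θ).integrableOn ω (Θ.measure ω)
  have h2 := ((isBoundedMeasurable_cum Θ).add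
    ((isBoundedMeasurable_jump Θ).mul (IsBoundedMeasurable.const (1 / 2)))).integrableOn ω
      (Θ.measure ω)
  have h3 := (isBoundedMeasurable_one_sub_decay Ψ).integrableOn ω (Θ.measure ω)
  have h12 : IntegrableOn (fun t => M.tempImpact d₀ Θ t ω + M.K t / 2 * Θ.jump t ω
      + M.γ * (Θ.cum t ω + Θ.jump t ω * (1 / 2))) (Icc 0 M.T) (Θ.measure ω) :=
    h1.add (h2.const_mul M.γ)
  rw [setIntegral_congr_fun measurableSet_Icc fun t ht => impact_add_jump_eq d₀ Θ Ψ ht ω,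
    integral_add h12 (h3.const_mul (-M.γ)),
    integral_add h1 (h2.const_mul M.γ), integral_const_mul, integral_const_mul,
    ← integral_cum_add_jump, tempCost, crossImpact]
  simp only [mul_one_div, neg_mul]
  ring

theorem cost_eq_of_integrableOn (d₀ e₀ : ℝ) (Θ Ψ : OrderProcess M) {ω : Ω}
    (hA : IntegrableOn (fun t => M.Au t ω) (Icc 0 M.T) (Θ.measure ω))
    (hB : IntegrableOn (fun t => M.Bu t ω) (Icc 0 M.T) (Ψ.measure ω)) :
    M.cost d₀ e₀ Θ Ψ ω =
      ((∫ t in Icc 0 M.T, M.Au t ω ∂Θ.measure ω) - ∫ t in Icc 0 M.T, M.Bu t ω ∂Ψ.measure ω) +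
      ((∫ t in Icc 0 M.T, (M.impact d₀ Θ Ψ t ω + Θ.jump t ω / (2 * M.q t)) ∂Θ.measure ω) +
      ∫ t in Icc 0 M.T, (M.impact e₀ Ψ Θ t ω + Ψ.jump t ω / (2 * M.q t)) ∂Ψ.measure ω) := by
  simp only [cost, ask, bid, add_assoc, sub_sub]
  rw [integral_add hA (integrableOn_impact_add_jump d₀ Θ Ψ ω _),
    integral_sub hB (integrableOn_impact_add_jump e₀ Ψ Θ ω _)]
  ring

theorem tempImpact_nonneg {d₀ : ℝ} (hd : 0 ≤ d₀) (Θ : OrderProcess M) {t : ℝ}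
    (ht : t ∈ Icc 0 M.T) (ω : Ω) : 0 ≤ M.tempImpact d₀ Θ t ω :=
  add_nonneg (mul_nonneg hd (decay_nonneg 0 t)) <| setIntegral_nonneg measurableSet_Ico
    fun s hs => mul_nonneg (M.K_pos s ⟨hs.1, hs.2.le.trans ht.2⟩).le (decay_nonneg s t)

theorem tempImpact_add_jump_nonneg {d₀ : ℝ} (hd : 0 ≤ d₀) (Θ : OrderProcess M) {t : ℝ}
    (ht : t ∈ Icc 0 M.T) (ω : Ω) : 0 ≤ M.tempImpact d₀ Θ t ω + M.K t / 2 * Θ.jump t ω :=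
  add_nonneg (tempImpact_nonneg hd Θ ht ω) <| mul_nonneg (half_pos (M.K_pos t ht)).le
    (Θ.measure_real_singleton t ω ▸ measureReal_nonneg)

theorem tempCost_nonneg {d₀ : ℝ} (hd : 0 ≤ d₀) (Θ : OrderProcess M) (ω : Ω) :
    0 ≤ M.tempCost d₀ Θ ω :=
  setIntegral_nonneg measurableSet_Icc fun _ ht => tempImpact_add_jump_nonneg hd Θ ht ω

/-- The temporary impact costs increase with the measure of the orders. -/
theorem tempCost_mono {d₀ : ℝ} (hd : 0 ≤ d₀) {Θ Ξ : OrderProcess M} {ω : Ω}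
    (h : Ξ.measure ω ≤ Θ.measure ω) : M.tempCost d₀ Ξ ω ≤ M.tempCost d₀ Θ ω := by
  have hle : ∀ t ∈ Icc 0 M.T, M.tempImpact d₀ Ξ t ω + M.K t / 2 * Ξ.jump t ω ≤
      M.tempImpact d₀ Θ t ω + M.K t / 2 * Θ.jump t ω := by
    intro t ht
    have h1 : ∫ s in Ico 0 t, M.K s * M.decay s t ∂Ξ.measure ω ≤
        ∫ s in Ico 0 t, M.K s * M.decay s t ∂Θ.measure ω :=
      integral_mono_measure (Measure.restrict_mono le_rfl h)
        ((ae_restrict_mem measurableSet_Ico).mono fun s hs =>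
          mul_nonneg (M.K_pos s ⟨hs.1, hs.2.le.trans ht.2⟩).le (decay_nonneg s t))
        (isBoundedOnTriangle_K_mul_decay.integrableOn ht.2 _)
    have h2 : Ξ.jump t ω ≤ Θ.jump t ω := by
      rw [← Ξ.measure_real_singleton, ← Θ.measure_real_singleton]
      exact ENNReal.toReal_mono (measure_ne_top _ _) (h _)
    exact add_le_add (add_le_add_right h1 _)
      (mul_le_mul_of_nonneg_left h2 (half_pos (M.K_pos t ht)).le)
  have hΘ := (isBoundedMeasurable_temp_add_jump d₀ Θ)
  calc M.tempCost d₀ Ξ ω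
      ≤ ∫ t in Icc 0 M.T, (M.tempImpact d₀ Θ t ω + M.K t / 2 * Θ.jump t ω) ∂Ξ.measure ω :=
        setIntegral_mono_on ((isBoundedMeasurable_temp_add_jump d₀ Ξ).integrableOn ω _)
          (hΘ.integrableOn ω _) measurableSet_Icc hle
    _ ≤ M.tempCost d₀ Θ ω :=
        integral_mono_measure (Measure.restrict_mono le_rfl h)
          ((ae_restrict_mem measurableSet_Icc).mono fun t ht =>
            tempImpact_add_jump_nonneg hd Θ ht ω)
          (hΘ.integrableOn ω _)

end DynamicSpreadModel

/-! ### Expected costs of buy programs -/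

namespace DynamicSpreadModel

variable {Ω : Type*} [MeasurableSpace Ω] {P : Measure Ω} {M : DynamicSpreadModel P}

theorem ae_cost_eq (d₀ e₀ : ℝ) (Θ Ψ : OrderProcess M) : ∀ᵐ ω ∂P, M.cost d₀ e₀ Θ Ψ ω =
      ((∫ t in Icc 0 M.T, M.Au t ω ∂Θ.measure ω) - ∫ t in Icc 0 M.T, M.Bu t ω ∂Ψ.measure ω) +
      ((∫ t in Icc 0 M.T, (M.impact d₀ Θ Ψ t ω + Θ.jump t ω / (2 * M.q t)) ∂Θ.measure ω) +
      ∫ t in Icc 0 M.T, (M.impact e₀ Ψ Θ t ω + Ψ.jump t ω / (2 * M.q t)) ∂Ψ.measure ω) := by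
  filter_upwards [M.ask_martingale.ae_integrableOn Θ, M.bid_martingale.ae_integrableOn Ψ]
    with ω hA hB using cost_eq_of_integrableOn d₀ e₀ Θ Ψ hA hB

theorem builds_trunc {x : ℝ} (hx : 0 ≤ x) {Θ Ψ : OrderProcess M} (h : M.Builds x Θ Ψ) :
    M.Builds x (Θ.trunc x hx) 0 := by
  filter_upwards [h] with ω hω
  change min (Θ.final ω) x - 0 = x
  rw [sub_zero, min_eq_right]
  linarith [Ψ.final_nonneg ω]

/-- Sales at the bid price earn at most what they would earn at the ask price, and the permanent
impact costs are at least those of the net order. -/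
theorem ae_le_cost (d₀ : ℝ) {e₀ : ℝ} (he : 0 ≤ e₀) (Θ Ψ : OrderProcess M) :
    ∀ᵐ ω ∂P, ((∫ t in Icc 0 M.T, M.Au t ω ∂Θ.measure ω) -
        ∫ t in Icc 0 M.T, M.Au t ω ∂Ψ.measure ω) +
      (M.γ / 2 * (Θ.final ω - Ψ.final ω) ^ 2 + M.tempCost d₀ Θ ω) ≤ M.cost d₀ e₀ Θ Ψ ω := by
  filter_upwards [ae_cost_eq d₀ e₀ Θ Ψ, M.ask_martingale.ae_integrableOn Ψ,
    M.bid_martingale.ae_integrableOn Ψ, M.bid_le_ask] with ω hω hA hB hle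
  rw [hω, integral_impact_add_jump, integral_impact_add_jump]
  have h1 : ∫ t in Icc 0 M.T, M.Bu t ω ∂Ψ.measure ω ≤ ∫ t in Icc 0 M.T, M.Au t ω ∂Ψ.measure ω :=
    setIntegral_mono_on hB hA measurableSet_Icc hle
  have h2 := mul_le_mul_of_nonneg_left (M.crossImpact_add_le Θ Ψ ω) M.γ_nonneg
  have h3 := M.tempCost_nonneg he Ψ ω
  linarith

variable [IsProbabilityMeasure P]

theorem integrable_cost (d₀ e₀ : ℝ) (Θ Ψ : OrderProcess M) :
    Integrable (M.cost d₀ e₀ Θ Ψ) P :=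
  (((M.ask_martingale.integral_integral Θ).1.sub (M.bid_martingale.integral_integral Ψ).1).add
    ((integrable_integral_impact_add_jump d₀ Θ Ψ).add
      (integrable_integral_impact_add_jump e₀ Ψ Θ))).congr
    ((ae_cost_eq d₀ e₀ Θ Ψ).mono fun _ h => h.symm)

theorem integral_ask_of_builds {x : ℝ} {Θ Ψ : OrderProcess M} (h : M.Builds x Θ Ψ) :
    ∫ ω, ((∫ t in Icc 0 M.T, M.Au t ω ∂Θ.measure ω) -
      ∫ t in Icc 0 M.T, M.Au t ω ∂Ψ.measure ω) ∂P = M.a₀ * x := by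
  have hΘ := M.ask_martingale.integral_integral Θ
  have hΨ := M.ask_martingale.integral_integral Ψ
  have hint : ∀ Θ : OrderProcess M, Integrable (fun ω => M.Au M.T ω * Θ.final ω) P := by
    intro Θ
    obtain ⟨C, hC⟩ := Θ.exists_final_le
    exact M.ask_martingale.integrable_mul ⟨M.T, M.T_nonneg, le_rfl⟩ Θ.measurable_final
      fun ω => (abs_of_nonneg (Θ.final_nonneg ω)).trans_le (hC ω)
  rw [integral_sub hΘ.1 hΨ.1, hΘ.2, hΨ.2, ← integral_sub (hint Θ) (hint Ψ),
    ← M.ask_martingale.integral_terminal, ← integral_mul_const]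
  refine integral_congr_ae ?_
  filter_upwards [h] with ω hω
  rw [← mul_sub, hω]

/-- Omitting the sales and stopping the purchases once the target is reached does not increase the
expected costs. -/
theorem le_expectedCost {x : ℝ} (hx : 0 ≤ x) {d₀ e₀ : ℝ} (hd : 0 ≤ d₀) (he : 0 ≤ e₀)
    {Θ Ψ : OrderProcess M} (h : M.Builds x Θ Ψ) :
    M.a₀ * x + M.γ / 2 * x ^ 2 + ∫ ω, M.tempCost d₀ (Θ.trunc x hx) ω ∂P
      ≤ M.expectedCost d₀ e₀ Θ Ψ := by
  have hA : Integrable (fun ω => (∫ t in Icc 0 M.T, M.Au t ω ∂Θ.measure ω) -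
      ∫ t in Icc 0 M.T, M.Au t ω ∂Ψ.measure ω) P :=
    (M.ask_martingale.integral_integral Θ).1.sub (M.ask_martingale.integral_integral Ψ).1
  have hJ := M.integrable_tempCost d₀ (Θ.trunc x hx)
  have hγ : Integrable (fun _ : Ω => M.γ / 2 * x ^ 2) P := integrable_const _
  have hγJ : Integrable (fun ω => M.γ / 2 * x ^ 2 + M.tempCost d₀ (Θ.trunc x hx) ω) P := hγ.add hJ
  calc M.a₀ * x + M.γ / 2 * x ^ 2 + ∫ ω, M.tempCost d₀ (Θ.trunc x hx) ω ∂P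
      = ∫ ω, (((∫ t in Icc 0 M.T, M.Au t ω ∂Θ.measure ω) -
          ∫ t in Icc 0 M.T, M.Au t ω ∂Ψ.measure ω) +
          (M.γ / 2 * x ^ 2 + M.tempCost d₀ (Θ.trunc x hx) ω)) ∂P := by
        rw [integral_add hA hγJ, integral_add hγ hJ, integral_ask_of_builds h,
          integral_const]
        simp [add_assoc]
    _ ≤ M.expectedCost d₀ e₀ Θ Ψ := by
        refine integral_mono_ae (hA.add hγJ) (integrable_cost d₀ e₀ Θ Ψ) ?_
        filter_upwards [ae_le_cost d₀ he Θ Ψ, h] with ω h1 h2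
        rw [h2] at h1
        exact (add_le_add_right (add_le_add_right
          (tempCost_mono hd (Θ.measure_trunc_le x hx ω)) _) _).trans h1

theorem integral_permanent_cost {x : ℝ} {Θ : OrderProcess M} (h : M.Builds x Θ 0) :
    ∫ ω, (∫ t in Icc 0 M.T, M.γ * (Θ.cum t ω + Θ.jump t ω / 2) ∂Θ.measure ω) ∂P
      = M.γ / 2 * x ^ 2 := by
  have h' : (fun ω => ∫ t in Icc 0 M.T, M.γ * (Θ.cum t ω + Θ.jump t ω / 2) ∂Θ.measure ω)
      =ᵐ[P] fun _ => M.γ / 2 * x ^ 2 := by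
    filter_upwards [h] with ω hω
    have hω' : Θ.final ω = x := (sub_zero _).symm.trans hω
    rw [integral_const_mul, integral_cum_add_jump, hω']
    ring
  rw [integral_congr_ae h']
  simp

theorem integral_ask_of_builds_zero {x : ℝ} {Θ : OrderProcess M} (h : M.Builds x Θ 0) :
    ∫ ω, (∫ t in Icc 0 M.T, M.Au t ω ∂Θ.measure ω) ∂P = M.a₀ * x := by
  rw [← integral_ask_of_builds h]
  simp [OrderProcess.measure_zero]

theorem expectedCost_zero_right {x : ℝ} (d₀ e₀ : ℝ) {Θ : OrderProcess M} (h : M.Builds x Θ 0) :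
    M.expectedCost d₀ e₀ Θ 0
      = M.a₀ * x + M.γ / 2 * x ^ 2 + ∫ ω, M.tempCost d₀ Θ ω ∂P := by
  have hγ : Integrable (fun _ : Ω => M.γ / 2 * x ^ 2) P := integrable_const _
  have hA := (M.ask_martingale.integral_integral Θ).1
  have hJ := M.integrable_tempCost d₀ Θ
  have hγJ : Integrable (fun ω => M.γ / 2 * x ^ 2 + M.tempCost d₀ Θ ω) P := hγ.add hJ
  have h' : M.cost d₀ e₀ Θ 0 =ᵐ[P] fun ω => (∫ t in Icc 0 M.T, M.Au t ω ∂Θ.measure ω) +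
      (M.γ / 2 * x ^ 2 + M.tempCost d₀ Θ ω) := by
    filter_upwards [ae_cost_eq d₀ e₀ Θ 0, h] with ω h1 h2
    have hω' : Θ.final ω = x := (sub_zero _).symm.trans h2
    rw [h1, integral_impact_add_jump, hω']
    simp only [crossImpact, OrderProcess.measure_zero, Measure.restrict_zero,
      integral_zero_measure, integral_zero]
    ring
  rw [expectedCost, integral_congr_ae h', integral_add hA hγJ, integral_add hγ hJ,
    integral_ask_of_builds_zero h, integral_const]
  simp [add_assoc]

/-- Every buy program is at least as expensive as its purchases stopped at the target. -/
theorem expectedCost_trunc_le {x : ℝ} (hx : 0 ≤ x) {d₀ e₀ : ℝ} (hd : 0 ≤ d₀) (he : 0 ≤ e₀)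
    {Θ Ψ : OrderProcess M} (h : M.Builds x Θ Ψ) :
    M.expectedCost d₀ e₀ (Θ.trunc x hx) 0 ≤ M.expectedCost d₀ e₀ Θ Ψ :=
  (expectedCost_zero_right d₀ e₀ (builds_trunc hx h)).trans_le (le_expectedCost hx hd he h)

end DynamicSpreadModel

/-! ### Sell programs by reflection of the order book -/

section Reflection

variable {Ω : Type*} [MeasurableSpace Ω] {P : Measure Ω}

theorem IsCadlagOn.neg {T : ℝ} {f : ℝ → ℝ} (hf : IsCadlagOn T f) :
    IsCadlagOn T fun t => -f t :=
  ⟨fun t ht => (hf.1 t ht).neg, fun t ht => (hf.2 t ht).imp' Neg.neg fun _ h => h.neg⟩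

theorem IsH1Martingale.neg {T : ℝ} {ℱ : Filtration (Icc (0 : ℝ) T) ‹MeasurableSpace Ω›}
    {Z : ℝ → Ω → ℝ} {z₀ : ℝ} (hZ : IsH1Martingale P ℱ Z z₀) :
    IsH1Martingale P ℱ (fun t ω => -Z t ω) (-z₀) where
  martingale := hZ.martingale.neg
  cadlag := hZ.cadlag.mono fun _ h => h.neg
  sup_integrable := by simpa only [abs_neg] using hZ.sup_integrable
  start := hZ.start.mono fun _ h => congrArg Neg.neg h

namespace DynamicSpreadModel

/-- The reflected order book: prices change their sign, so that the two sides of the book and the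
roles of purchases and sales are interchanged. -/
def reflect (M : DynamicSpreadModel P) : DynamicSpreadModel P where
  T := M.T
  T_nonneg := M.T_nonneg
  ℱ := M.ℱ
  usual := M.usual
  Au t ω := -M.Bu t ω
  a₀ := -M.b₀
  Bu t ω := -M.Au t ω
  b₀ := -M.a₀
  ask_martingale := M.bid_martingale.neg
  bid_martingale := M.ask_martingale.neg
  bid_le_ask := M.bid_le_ask.mono fun _ h t ht => neg_le_neg (h t ht)
  γ := M.γ
  γ_nonneg := M.γ_nonneg
  K := M.K
  K_pos := M.K_pos
  K_bounded := M.K_bounded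
  K_borel := M.K_borel
  ρ := M.ρ
  ρ_pos := M.ρ_pos
  ρ_integrable := M.ρ_integrable

end DynamicSpreadModel

/-- An order process, read as an order process of the reflected book. -/
def OrderProcess.reflect {M : DynamicSpreadModel P} (Θ : OrderProcess M) :
    OrderProcess M.reflect where
  cum := Θ.cum
  final := Θ.final
  eq_zero := Θ.eq_zero
  eq_final := Θ.eq_final
  mono := Θ.mono
  left_cont := Θ.left_cont
  bounded := Θ.bounded
  adapted := Θ.adapted
  final_measurable := Θ.final_measurable

namespace DynamicSpreadModel

variable {M : DynamicSpreadModel P}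

theorem expectedCost_reflect (d₀ e₀ : ℝ) (Θ Ψ : OrderProcess M) :
    M.reflect.expectedCost e₀ d₀ Ψ.reflect Θ.reflect = M.expectedCost d₀ e₀ Θ Ψ := by
  have himp : ∀ (c : ℝ) (Θ Ψ : OrderProcess M) (t : ℝ) (ω : Ω),
      M.reflect.impact c Θ.reflect Ψ.reflect t ω = M.impact c Θ Ψ t ω := fun _ _ _ _ _ => rfl
  refine integral_congr_ae (ae_of_all _ fun ω => ?_)
  have hask : ∀ t, M.reflect.ask e₀ Ψ.reflect Θ.reflect t ω
      + Ψ.reflect.jump t ω / (2 * M.reflect.q t) =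
      -(M.bid e₀ Θ Ψ t ω - Ψ.jump t ω / (2 * M.q t)) := by
    intro t
    rw [ask, bid, himp]
    change -M.Bu t ω + M.impact e₀ Ψ Θ t ω + Ψ.jump t ω / (2 * M.q t) = _
    ring
  have hbid : ∀ t, M.reflect.bid d₀ Ψ.reflect Θ.reflect t ω
      - Θ.reflect.jump t ω / (2 * M.reflect.q t) =
      -(M.ask d₀ Θ Ψ t ω + Θ.jump t ω / (2 * M.q t)) := by
    intro t
    rw [ask, bid, himp]
    change -M.Au t ω - M.impact d₀ Θ Ψ t ω - Θ.jump t ω / (2 * M.q t) = _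
    ring
  simp only [cost, hask, hbid, integral_neg]
  change -(∫ t in Icc 0 M.T, (M.bid e₀ Θ Ψ t ω - Ψ.jump t ω / (2 * M.q t)) ∂Ψ.measure ω)
    - -(∫ t in Icc 0 M.T, (M.ask d₀ Θ Ψ t ω + Θ.jump t ω / (2 * M.q t)) ∂Θ.measure ω) = _
  ring

theorem builds_reflect {x : ℝ} {Θ Ψ : OrderProcess M} (h : M.Builds x Θ Ψ) :
    M.reflect.Builds (-x) Ψ.reflect Θ.reflect :=
  h.mono fun ω hω => by
    rw [← hω, neg_sub]
    rfl

theorem builds_trunc_of_nonpos {x : ℝ} (hx : 0 ≤ -x) {Θ Ψ : OrderProcess M}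
    (h : M.Builds x Θ Ψ) : M.Builds x 0 (Ψ.trunc (-x) hx) := by
  filter_upwards [h] with ω hω
  change 0 - min (Ψ.final ω) (-x) = x
  rw [min_eq_right (by linarith [Θ.final_nonneg ω])]
  ring

variable [IsProbabilityMeasure P]

/-- Every sell program is at least as expensive as its sales stopped at the target. -/
theorem expectedCost_trunc_le_of_nonpos {x : ℝ} (hx : 0 ≤ -x) {d₀ e₀ : ℝ} (hd : 0 ≤ d₀)
    (he : 0 ≤ e₀) {Θ Ψ : OrderProcess M} (h : M.Builds x Θ Ψ) :
    M.expectedCost d₀ e₀ 0 (Ψ.trunc (-x) hx) ≤ M.expectedCost d₀ e₀ Θ Ψ := by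
  rw [← expectedCost_reflect, ← expectedCost_reflect d₀ e₀ Θ Ψ]
  exact expectedCost_trunc_le hx he hd (builds_reflect h)

theorem not_admitsTransactionTriggeredPriceManipulation :
    ¬ M.AdmitsTransactionTriggeredPriceManipulation := by
  rintro (⟨x, d₀, e₀, hx, hd, he, Θ, Ψ, h, hlt⟩ | ⟨x, d₀, e₀, hx, hd, he, Θ, Ψ, h, hlt⟩)
  · refine hlt.not_ge ((iInf₂_le (Θ.trunc x hx) (builds_trunc hx h)).trans ?_)
    exact EReal.coe_le_coe_iff.2 (expectedCost_trunc_le hx hd he h)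
  · have hx' : 0 ≤ -x := neg_nonneg.2 hx
    refine hlt.not_ge ((iInf₂_le (Ψ.trunc (-x) hx') (builds_trunc_of_nonpos hx' h)).trans ?_)
    exact EReal.coe_le_coe_iff.2 (expectedCost_trunc_le_of_nonpos hx' hd he h)

theorem not_admitsPriceManipulation : ¬ M.AdmitsPriceManipulation := by
  rintro ⟨d₀, e₀, hd, he, Θ, Ψ, h, hlt⟩
  have h1 := le_expectedCost le_rfl hd he h
  have h2 : 0 ≤ ∫ ω, M.tempCost d₀ (Θ.trunc 0 le_rfl) ω ∂P :=
    integral_nonneg fun ω => tempCost_nonneg hd _ ω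
  simp only [mul_zero, zero_pow two_ne_zero, zero_add] at h1
  exact hlt.not_ge (h2.trans h1)

end DynamicSpreadModel

end Reflection

/-! ### Absence of price manipulation -/

theorem mainTheorem1 {Ω : Type*} [MeasurableSpace Ω] (P : Measure Ω) [IsProbabilityMeasure P]
    (M : DynamicSpreadModel P) :
    -- no transaction-triggered price manipulation, and no price manipulation
    ¬ M.AdmitsTransactionTriggeredPriceManipulation ∧
    ¬ M.AdmitsPriceManipulation ∧
    -- the lower bound for the expected costs of buy programs
    (∀ (x : ℝ) (hx : 0 ≤ x) (d₀ e₀ : ℝ), 0 ≤ d₀ → 0 ≤ e₀ →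
      ∀ Θ Ψ : OrderProcess M, M.Builds x Θ Ψ →
        Integrable (M.cost d₀ e₀ Θ Ψ) P ∧
        M.Builds x (Θ.trunc x hx) 0 ∧
        Integrable (M.tempCost d₀ (Θ.trunc x hx)) P ∧
        M.a₀ * x + M.γ / 2 * x ^ 2 + ∫ ω, M.tempCost d₀ (Θ.trunc x hx) ω ∂P
          ≤ M.expectedCost d₀ e₀ Θ Ψ) ∧
    -- the expected costs of pure purchasing strategies: martingale part, permanent impact part, total
    (∀ x d₀ e₀ : ℝ, 0 ≤ x → 0 ≤ d₀ → 0 ≤ e₀ → ∀ Θ : OrderProcess M, M.Builds x Θ 0 →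
        ∫ ω, (∫ t in Icc 0 M.T, M.Au t ω ∂Θ.measure ω) ∂P = M.a₀ * x ∧
        ∫ ω, (∫ t in Icc 0 M.T, M.γ * (Θ.cum t ω + Θ.jump t ω / 2) ∂Θ.measure ω) ∂P
          = M.γ / 2 * x ^ 2 ∧
        M.expectedCost d₀ e₀ Θ 0
          = M.a₀ * x + M.γ / 2 * x ^ 2 + ∫ ω, M.tempCost d₀ Θ ω ∂P) := by
  refine ⟨M.not_admitsTransactionTriggeredPriceManipulation, M.not_admitsPriceManipulation, ?_, ?_⟩
  · intro x hx d₀ e₀ hd he Θ Ψ h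
    exact ⟨M.integrable_cost d₀ e₀ Θ Ψ, M.builds_trunc hx h, M.integrable_tempCost d₀ _,
      M.le_expectedCost hx hd he h⟩
  · intro x d₀ e₀ _ _ _ Θ h
    exact ⟨M.integral_ask_of_builds_zero h, M.integral_permanent_cost h,
      M.expectedCost_zero_right d₀ e₀ h⟩
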